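/- Let $\varphi$ be the Thue--Morse morphism $0\mapsto 01$, $1\mapsto 10$ on binary words (finite or infinite), and let $\mathbf{t}=01101001\cdots$ be the Thue--Morse word, the fixed point of $\varphi$ that starts with $0$. For finite words $u,w$, let $\binom{u}{w}$ be the number of times $w$ occurs as a (scattered) subword of $u$, that is, the number of increasing sequences of $|w|$ positions of $u$ at which one reads $w$. For $j\ge 1$, two finite words $u,v$ are $j$-binomially equivalent, $u\sim_j v$, if $\binom{u}{w}=\binom{v}{w}$ for all words $w$ of length at most $j$. The $j$-binomial complexity $\mathsf{b}^{(j)}_{\mathbf{x}}\colon\mathbb{N}\to\mathbb{N}$ of an infinite word $\mathbf{x}$ maps $n$ to the number of $\sim_j$-classes of factors (contiguous subwords) of length $n$ of $\mathbf{x}$. An infinite word is recurrent if each of its factors occurs in it infinitely often. Theorem. Let $k\ge 1$ and let $\mathbf{x}\in\{0,1\}^{\mathbb{N}}$ be a recurrent binary word such that $\mathsf{b}^{(j)}_{\mathbf{x}}=\mathsf{b}^{(j)}_{\mathbf{t}}$ for all $1\le j\le k$. Then there exist an infinite binary word $\mathbf{y}\in\{0,1\}^{\mathbb{N}}$ and a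 (possibly empty) proper suffix $u$ of $\varphi^k(0)$ or of $\varphi^k(1)$ such that $\mathbf{x}=u\varphi^k(\mathbf{y})$. -/

import Mathlib

namespace BinomialWords

/-- The binomial coefficient of the words `u` and `w`: the number of increasing sequences of
positions of `u` (indexed by the positions of `w`) at which one reads `w`. -/
noncomputable def binom {α : Type*} (u w : List α) : ℕ :=
  Nat.card {i : Fin w.length → Fin u.length // StrictMono i ∧ ∀ j, u.get (i j) = w.get j}

/-- The `k`-binomial equivalence of finite words. -/
def binomSetoid (α : Type*) (k : ℕ) : Setoid (List α) where
  r u v := ∀ w : List α, w.length ≤ k → binom u w = binom v w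
  iseqv :=
    { refl := fun _ _ _ => rfl
      symm := fun h w hw => (h w hw).symm
      trans := fun h h' w hw => (h w hw).trans (h' w hw) }

/-- The word of length `n` that occurs in the infinite word `x` at position `i`. -/
def block {α : Type*} (x : ℕ → α) (i n : ℕ) : List α :=
  List.ofFn fun j : Fin n => x (i + j)

/-- The set of factors of length `n` of the infinite word `x`. -/
def factors {α : Type*} (x : ℕ → α) (n : ℕ) : Set (List α) :=
  Set.range fun i => block x i n

/-- The `k`-binomial complexity function of `x`: the number of `k`-binomial equivalence classes
of factors of length `n` (there are finitely many factors of length `n` over a finite alphabet). -/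
noncomputable def binomComplexity {α : Type*} (k : ℕ) (x : ℕ → α) (n : ℕ) : ℕ :=
  ((fun w => (Quotient.mk (binomSetoid α k) w)) '' factors x n).ncard

/-- An infinite word is recurrent if each of its factors occurs infinitely often. -/
def Recurrent {α : Type*} (x : ℕ → α) : Prop :=
  ∀ n, ∀ w ∈ factors x n, {i | block x i n = w}.Infinite

/-- The concatenation of the finite word `u` and the infinite word `x`. -/
def concat {α : Type*} (u : List α) (x : ℕ → α) : ℕ → α :=
  fun n => if h : n < u.length then u[n] else x (n - u.length)

/-- The images of the letters under the Thue–Morse morphism `0 ↦ 01`, `1 ↦ 10`. -/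
def tmLetter : Fin 2 → List (Fin 2)
  | 0 => [0, 1]
  | 1 => [1, 0]

/-- The Thue–Morse morphism on finite words. -/
def tm (u : List (Fin 2)) : List (Fin 2) :=
  u.flatMap tmLetter

/-- The Thue–Morse morphism on infinite words: `φ(y) = φ(y₀)φ(y₁)φ(y₂)⋯`, where each `φ(yᵢ)` has
length two. -/
def tmInf (y : ℕ → Fin 2) : ℕ → Fin 2 :=
  fun n => (tmLetter (y (n / 2))).getD (n % 2) 0

/-- The Thue–Morse word, the limit of the words `φⁿ(0)`: its letter at position `n` is the letter
at position `n` of `φⁿ(0)`, a word of length `2ⁿ`. -/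
def thueMorse : ℕ → Fin 2 :=
  fun n => (tm^[n] [0]).getD n 0

/-- A binary word has property `P(k)` if it has the same `j`-binomial complexity as the
Thue–Morse word for all `1 ≤ j ≤ k`. -/
def TMProp (k : ℕ) (x : ℕ → Fin 2) : Prop :=
  ∀ j, 1 ≤ j → j ≤ k → binomComplexity j x = binomComplexity j thueMorse

theorem tm_cons (a : Fin 2) (u : List (Fin 2)) : tm (a :: u) = tmLetter a ++ tm u := by
  simp [tm]

theorem length_tmLetter (a : Fin 2) : (tmLetter a).length = 2 := by
  fin_cases a <;> rfl

theorem length_tm (u : List (Fin 2)) : (tm u).length = 2 * u.length := by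
  induction u with
  | nil => rfl
  | cons a u ih => rw [tm_cons, List.length_append, ih, length_tmLetter, List.length_cons]; ring

theorem getD_tm (u : List (Fin 2)) (n : ℕ) (hn : n < 2 * u.length) :
    (tm u).getD n 0 = (tmLetter (u.getD (n / 2) 0)).getD (n % 2) 0 := by
  induction u generalizing n with
  | nil => simp at hn
  | cons a u ih =>
    rw [tm_cons]
    by_cases h : n < 2
    · rw [List.getD_append _ _ _ _ (by rw [length_tmLetter]; exact h), Nat.div_eq_of_lt h,
        Nat.mod_eq_of_lt h]
      rfl
    · obtain ⟨m, rfl⟩ : ∃ m, n = m + 2 := ⟨n - 2, by omega⟩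
      rw [List.getD_append_right _ _ _ _ (by rw [length_tmLetter]; omega), length_tmLetter,
        Nat.add_sub_cancel, ih m (by simp at hn; omega)]
      simp

/-- The image of an infinite word has the images of its prefixes as prefixes. -/
theorem block_tmInf (y : ℕ → Fin 2) (n : ℕ) : block (tmInf y) 0 (2 * n) = tm (block y 0 n) := by
  apply List.ext_getElem
  · simp [block, length_tm]
  · intro i h₁ h₂
    have hi : i < 2 * n := by simpa [block] using h₁
    have h := getD_tm (block y 0 n) i (by simpa [block] using hi)
    rw [List.getD_eq_getElem _ _ h₂] at h
    have hb : i / 2 < (block y 0 n).length := by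
      simp only [block, List.length_ofFn]
      omega
    rw [h, List.getD_eq_getElem _ _ hb]
    simp [block, tmInf]

theorem length_tm_iterate (m : ℕ) : (tm^[m] [0]).length = 2 ^ m := by
  induction m with
  | zero => rfl
  | succ m ih => rw [Function.iterate_succ_apply', length_tm, ih, pow_succ]; ring

/-- All the words `φᵐ(0)` are prefixes of the Thue–Morse word. -/
theorem getD_tm_iterate (m n : ℕ) (h : n < 2 ^ m) : (tm^[m] [0]).getD n 0 = thueMorse n := by
  induction n using Nat.strong_induction_on generalizing m with
  | _ n ih =>
    have key : ∀ p, n < 2 ^ (p + 1) → (tm^[p + 1] [0]).getD n 0 =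
        (tmLetter ((tm^[p] [0]).getD (n / 2) 0)).getD (n % 2) 0 := by
      intro p hp
      rw [Function.iterate_succ_apply', getD_tm _ _ (by rw [length_tm_iterate]; omega)]
    rcases Nat.eq_zero_or_pos n with rfl | hn
    · clear ih key
      induction m with
      | zero => rfl
      | succ m ihm =>
        rw [Function.iterate_succ_apply', getD_tm _ _ (by rw [length_tm_iterate]; positivity),
          Nat.zero_div, ihm (by positivity)]
        rfl
    · obtain ⟨q, rfl⟩ : ∃ q, n = q + 1 := ⟨n - 1, by omega⟩
      obtain ⟨p, rfl⟩ : ∃ p, m = p + 1 := by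
        cases m with
        | zero => simp at h
        | succ p => exact ⟨p, rfl⟩
      have hq : q + 1 < 2 ^ (q + 1) := Nat.lt_two_pow_self
      rw [key p h, thueMorse, key q hq, ih _ (by omega) p (by omega), ih _ (by omega) q (by omega)]

/-- The Thue–Morse word is the fixed point of the Thue–Morse morphism that starts with `0`. -/
theorem thueMorse_fixed : thueMorse 0 = 0 ∧ tmInf thueMorse = thueMorse := by
  refine ⟨rfl, funext fun n => ?_⟩
  have h : n < 2 ^ n := Nat.lt_two_pow_self
  rw [← getD_tm_iterate (n + 1) n (by omega), Function.iterate_succ_apply',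
    getD_tm _ _ (by rw [length_tm_iterate]; omega), getD_tm_iterate n (n / 2) (by omega)]
  rfl

end BinomialWords

open BinomialWords

/-!
The proof is by induction on `k`. If `x` is a suffix of `φᵏ(y)`, then by recurrence `x` and `φᵏ(y)`
have the same factors, so `φᵏ(y)` has the same `(k + 1)`-binomial complexity as `t = φᵏ(t)`, and it
suffices to show that `y` is `φ(z)` or `φ(z)` without its first letter.

Cut a window of `φᵏ(y)` along the images of letters. If `y` contains no cube `aaa`, then the class
of the window for `(k + 1)`-binomial equivalence amounts to the position of the window relative to
the cuts, the weight (number of letters `1`) of the covering factor of `y`, and the first and the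
last letter of this factor when their images are really cut. These letters are determined because,
reading `φᵏ(y)` as `φᵏ⁻¹(φ(y))`, the words `φᵏ⁻¹(u)` and `φᵏ⁻¹(v)` with `|u| = |v|` can be
`(k + 1)`-binomially equivalent only if the positions of the letters `1` have the same sum in `u` as
in `v`: for `k ≥ 2`, the polynomials `∑ⱼ binom(w, 1ʲ0) Xʲ` of the words `w = φᵏ⁻¹(1)` and
`w = φᵏ⁻¹(0)` differ by `Xᵏ⁻¹` times a polynomial with nonzero constant term.

Let `k ≥ 1`. Comparing with `t` at the length `2 · 2ᵏ`, and `5` if `k = 1`, excludes cubes from `y`.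
At the lengths `2ᵏM` and `2ᵏM + 1`, the complexity then counts the triples (first letter, weight,
last letter) of factors of `y` and the pairs made of the weight and one of the two letters, so that
`y` and `t` realise the same triples, length by length. Hence the numbers of letters `0` and `1`
differ by one in every factor of odd length of `y`. For `k = 0` this follows from the number of
weights at each length, since the weight changes by at most one when a window is shifted by one.
Finally, two equal adjacent letters of such a word never lie in the same image of a letter, so the
place where they occur fixes the parity of the cuts.
-/

namespace BinomialWords

section Binom

variable {α : Type*}

/-- The occurrences of `w` as a scattered subword of `u`, as maps from positions of `w` to
positions of `u`; their number is `binom u w`. -/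
def occurrences (u w : List α) : Set (Fin w.length → Fin u.length) :=
  {i | StrictMono i ∧ ∀ j, u.get (i j) = w.get j}

theorem ncard_occurrences (u w : List α) : (occurrences u w).ncard = binom u w := rfl

theorem binom_nil_right (u : List α) : binom u [] = 1 := by
  rw [← ncard_occurrences, Set.ncard_eq_one]
  exact ⟨fun j => j.elim0, Set.eq_singleton_iff_unique_mem.2
    ⟨⟨fun j => j.elim0, fun j => j.elim0⟩, fun i _ => funext fun j => j.elim0⟩⟩

theorem binom_nil_cons (a : α) (w : List α) : binom [] (a :: w) = 0 := by
  rw [← ncard_occurrences, Set.ncard_eq_zero]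
  exact Set.eq_empty_of_forall_notMem fun i => (i ⟨0, Nat.succ_pos _⟩).elim0

theorem succ_comp_mem_occurrences_cons {a : α} {u w : List α} {i : Fin w.length → Fin u.length} :
    Fin.succ ∘ i ∈ occurrences (a :: u) w ↔ i ∈ occurrences u w :=
  and_congr_left'
    ⟨fun h _ _ hj => Fin.succ_lt_succ_iff.1 (h hj), fun h => Fin.strictMono_succ.comp h⟩

theorem cons_mem_occurrences_cons_cons {a b : α} {u w : List α}
    {i : Fin w.length → Fin u.length} :
    (Fin.cons 0 (Fin.succ ∘ i) : Fin (w.length + 1) → Fin (u.length + 1)) ∈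
      occurrences (a :: u) (b :: w) ↔ a = b ∧ i ∈ occurrences u w := by
  have hmono : StrictMono (Fin.cons 0 (Fin.succ ∘ i) : Fin (w.length + 1) → Fin (u.length + 1)) ↔
      StrictMono (Fin.succ ∘ i) := by
    simp [Fin.strictMono_cons]
  exact (and_congr hmono Fin.forall_fin_succ).trans
    (and_left_comm.trans (and_congr_right' succ_comp_mem_occurrences_cons))

theorem exists_eq_succ_comp {ι : Type*} {n : ℕ} {i : ι → Fin (n + 1)} (hi : ∀ j, i j ≠ 0) :
    ∃ i', i = Fin.succ ∘ i' := by
  choose i' hi' using fun j => Fin.exists_succ_eq.2 (hi j)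
  exact ⟨i', funext fun j => (hi' j).symm⟩

theorem occurrences_cons_cons (a b : α) (u w : List α) :
    occurrences (a :: u) (b :: w) = (Fin.succ ∘ ·) '' occurrences u (b :: w) ∪
      (fun i => Fin.cons 0 (Fin.succ ∘ i)) '' {i | a = b ∧ i ∈ occurrences u w} := by
  ext i
  constructor
  · intro hi
    by_cases h0 : i ⟨0, Nat.succ_pos _⟩ = (0 : Fin (u.length + 1))
    · obtain ⟨i', hi'⟩ := exists_eq_succ_comp fun j : Fin w.length =>
        ((Fin.zero_le (i ⟨0, Nat.succ_pos _⟩)).trans_lt (hi.1 (Fin.succ_pos j))).ne'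
      have hcons : i = (Fin.cons 0 (Fin.succ ∘ i') : Fin (w.length + 1) → Fin (u.length + 1)) := by
        rw [← hi', ← h0]
        exact (Fin.cons_self_tail i).symm
      rw [hcons] at hi ⊢
      exact Or.inr ⟨i', cons_mem_occurrences_cons_cons.1 hi, rfl⟩
    · obtain ⟨i', rfl⟩ := exists_eq_succ_comp fun j =>
        ((Fin.pos_of_ne_zero h0).trans_le (hi.1.monotone (Fin.zero_le j))).ne'
      exact Or.inl ⟨i', succ_comp_mem_occurrences_cons.1 hi, rfl⟩
  · rintro (⟨i, hi, rfl⟩ | ⟨i, hi, rfl⟩)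
    · exact succ_comp_mem_occurrences_cons.2 hi
    · exact cons_mem_occurrences_cons_cons.2 hi

theorem binom_cons_cons [DecidableEq α] (a b : α) (u w : List α) :
    binom (a :: u) (b :: w) = binom u (b :: w) + if a = b then binom u w else 0 := by
  have hdisj : Disjoint ((Fin.succ ∘ ·) '' occurrences u (b :: w))
      ((fun i => (Fin.cons 0 (Fin.succ ∘ i) : Fin (w.length + 1) → Fin (u.length + 1))) ''
        {i | a = b ∧ i ∈ occurrences u w}) := by
    rw [Set.disjoint_left]
    rintro _ ⟨i, -, rfl⟩ ⟨i', -, h⟩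
    exact Fin.succ_ne_zero _ (congrFun h ⟨0, Nat.succ_pos _⟩).symm
  rw [← ncard_occurrences, occurrences_cons_cons, Set.ncard_union_eq hdisj (Set.toFinite _)
    (Set.toFinite _), Set.ncard_image_of_injective _ (Fin.succ_injective _).comp_left,
    Set.ncard_image_of_injective _ fun i i' h =>
      (Fin.succ_injective _).comp_left (Fin.cons_injective2 h).2, ncard_occurrences]
  split_ifs with h <;> simp [h, ncard_occurrences]

theorem binom_append (u v w : List α) :
    binom (u ++ v) w =
      ∑ i ∈ Finset.range (w.length + 1), binom u (w.take i) * binom v (w.drop i) := by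
  classical
  induction u generalizing w with
  | nil =>
    rw [Finset.sum_range_succ', Finset.sum_eq_zero]
    · simp [binom_nil_right]
    · intro i hi
      cases w with
      | nil => simp at hi
      | cons b w => simp [binom_nil_cons]
  | cons a u ih =>
    cases w with
    | nil => simp [binom_nil_right]
    | cons b w =>
      rw [List.cons_append, binom_cons_cons, ih, ih, List.length_cons,
        Finset.sum_range_succ' _ (w.length + 1), Finset.sum_range_succ' _ (w.length + 1)]
      simp only [List.take_succ_cons, List.drop_succ_cons, binom_cons_cons, List.take_zero,
        List.drop_zero, binom_nil_right, one_mul, add_mul, Finset.sum_add_distrib]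
      split_ifs <;> simp [add_right_comm]

/-- `k`-binomial equivalence, as a relation with explicit parameter `k`. -/
def BinomEquiv (k : ℕ) (u v : List α) : Prop :=
  binomSetoid α k u v

variable {k : ℕ} {u v u' v' : List α}

theorem BinomEquiv.refl (u : List α) : BinomEquiv k u u := (binomSetoid α k).refl u

theorem BinomEquiv.symm (h : BinomEquiv k u v) : BinomEquiv k v u := (binomSetoid α k).symm h

theorem BinomEquiv.trans (h : BinomEquiv k u v) (h' : BinomEquiv k v u') : BinomEquiv k u u' :=
  (binomSetoid α k).trans h h'

theorem BinomEquiv.mono {l : ℕ} (hl : l ≤ k) (h : BinomEquiv k u v) : BinomEquiv l u v :=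
  fun w hw => h w (hw.trans hl)

theorem BinomEquiv.append (h : BinomEquiv k u u') (h' : BinomEquiv k v v') :
    BinomEquiv k (u ++ v) (u' ++ v') := by
  intro w hw
  rw [binom_append, binom_append]
  refine Finset.sum_congr rfl fun i _ => ?_
  rw [h _ ((List.length_take_le' _ _).trans hw), h' _ (by rw [List.length_drop]; omega)]

theorem BinomEquiv.of_append_left (h : BinomEquiv k (u ++ v) (u ++ v')) : BinomEquiv k v v' := by
  intro w
  induction hn : w.length using Nat.strong_induction_on generalizing w with
  | _ n ih =>
    intro hw
    have hsum := h w (by omega)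
    have hterms : ∀ i ∈ Finset.range w.length,
        binom u (w.take (i + 1)) * binom v (w.drop (i + 1)) =
          binom u (w.take (i + 1)) * binom v' (w.drop (i + 1)) := fun i hi => by
      rw [Finset.mem_range] at hi
      rw [ih (w.drop (i + 1)).length (by rw [List.length_drop]; omega) _ rfl
        (by rw [List.length_drop]; omega)]
    rw [binom_append, binom_append, Finset.sum_range_succ', Finset.sum_range_succ',
      Finset.sum_congr rfl hterms] at hsum
    simpa [binom_nil_right] using hsum

theorem BinomEquiv.of_append_right (h : BinomEquiv k (u ++ v) (u' ++ v)) : BinomEquiv k u u' := by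
  intro w
  induction hn : w.length using Nat.strong_induction_on generalizing w with
  | _ n ih =>
    intro hw
    have hsum := h w (by omega)
    have hterms : ∀ i ∈ Finset.range w.length, binom u (w.take i) * binom v (w.drop i) =
        binom u' (w.take i) * binom v (w.drop i) := fun i hi => by
      rw [Finset.mem_range] at hi
      rw [ih (w.take i).length (by rw [List.length_take]; omega) _ rfl
        (by rw [List.length_take]; omega)]
    rw [binom_append, binom_append, Finset.sum_range_succ, Finset.sum_range_succ,
      Finset.sum_congr rfl hterms] at hsum
    simpa [binom_nil_right] using hsum

theorem binomEquiv_append_append_iff (p s : List α) :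
    BinomEquiv k (p ++ u ++ s) (p ++ v ++ s) ↔ BinomEquiv k u v :=
  ⟨fun h => h.of_append_right.of_append_left,
    fun h => ((BinomEquiv.refl p).append h).append (BinomEquiv.refl s)⟩

theorem BinomEquiv.append_comm (h : BinomEquiv k u v) : BinomEquiv (k + 1) (u ++ v) (v ++ u) := by
  intro w hw
  cases w with
  | nil => simp [binom_nil_right]
  | cons b w =>
    have hinner : ∀ i ∈ Finset.range w.length,
        binom u ((b :: w).take (i + 1)) * binom v ((b :: w).drop (i + 1)) =
          binom v ((b :: w).take (i + 1)) * binom u ((b :: w).drop (i + 1)) := by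
      intro i hi
      rw [Finset.mem_range] at hi
      rw [List.length_cons] at hw
      rw [h _ (by rw [List.length_take, List.length_cons]; omega),
        h _ (by rw [List.length_drop, List.length_cons]; omega)]
    rw [binom_append, binom_append, List.length_cons, Finset.sum_range_succ, Finset.sum_range_succ',
      Finset.sum_range_succ _ (w.length + 1), Finset.sum_range_succ' _ w.length,
      Finset.sum_congr rfl hinner]
    simp only [List.take_zero, List.drop_zero, binom_nil_right, one_mul, List.take_succ_cons,
      List.drop_succ_cons, List.take_length, List.drop_length, mul_one]
    ring

end Binom

section Images

theorem tm_append (u v : List (Fin 2)) : tm (u ++ v) = tm u ++ tm v :=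
  List.flatMap_append

theorem tm_iterate_append (k : ℕ) (u v : List (Fin 2)) :
    tm^[k] (u ++ v) = tm^[k] u ++ tm^[k] v := by
  induction k with
  | zero => rfl
  | succ k ih => simp only [Function.iterate_succ_apply', ih, tm_append]

theorem tm_iterate_cons (k : ℕ) (a : Fin 2) (u : List (Fin 2)) :
    tm^[k] (a :: u) = tm^[k] [a] ++ tm^[k] u := tm_iterate_append k [a] u

theorem tm_iterate_succ_singleton (k : ℕ) (a : Fin 2) :
    tm^[k + 1] [a] = tm^[k] [a] ++ tm^[k] [1 - a] := by
  fin_cases a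
  exacts [tm_iterate_cons k 0 [1], tm_iterate_cons k 1 [0]]

theorem length_tm_iterate_eq (k : ℕ) (u : List (Fin 2)) :
    (tm^[k] u).length = 2 ^ k * u.length := by
  induction k with
  | zero => simp
  | succ k ih => rw [Function.iterate_succ_apply', length_tm, ih, pow_succ']; ring

theorem count_one_cons (a : Fin 2) (u : List (Fin 2)) :
    (a :: u).count 1 = a.val + u.count 1 := by
  fin_cases a <;> simp [add_comm]

theorem count_zero_add_count_one (u : List (Fin 2)) : u.count 0 + u.count 1 = u.length := by
  induction u with
  | nil => rfl
  | cons a u ih => fin_cases a <;> simp <;> omega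

theorem perm_of_count_one_eq {u v : List (Fin 2)} (hl : u.length = v.length)
    (h : u.count 1 = v.count 1) : u.Perm v := by
  rw [List.perm_iff_count, Fin.forall_fin_two]
  exact ⟨by have := count_zero_add_count_one u; have := count_zero_add_count_one v; omega, h⟩

theorem count_one_tm (u : List (Fin 2)) : (tm u).count 1 = u.length := by
  induction u with
  | nil => rfl
  | cons a u ih =>
    rw [tm_cons, List.count_append, ih]
    fin_cases a <;> simp [tmLetter, add_comm]

theorem count_one_tm_iterate_succ (k : ℕ) (u : List (Fin 2)) :
    (tm^[k + 1] u).count 1 = 2 ^ k * u.length := by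
  rw [Function.iterate_succ_apply', count_one_tm, length_tm_iterate_eq]

theorem binomEquiv_tm_iterate_singleton (k : ℕ) (a b : Fin 2) :
    BinomEquiv k (tm^[k] [a]) (tm^[k] [b]) := by
  induction k generalizing a b with
  | zero =>
    intro w hw
    rw [List.length_eq_zero_iff.1 (Nat.le_zero.1 hw), binom_nil_right, binom_nil_right]
  | succ k ih =>
    have h : BinomEquiv (k + 1) (tm^[k + 1] [0]) (tm^[k + 1] [1]) := by
      simpa only [tm_iterate_succ_singleton, sub_zero, sub_self] using (ih 0 1).append_comm
    fin_cases a <;> fin_cases b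
    exacts [BinomEquiv.refl _, h, h.symm, BinomEquiv.refl _]

theorem binomEquiv_tm_iterate_of_perm (k : ℕ) {u v : List (Fin 2)} (h : u.Perm v) :
    BinomEquiv (k + 1) (tm^[k] u) (tm^[k] v) := by
  induction h with
  | nil => exact BinomEquiv.refl _
  | @cons a u v _ ih =>
    rw [tm_iterate_cons k a u, tm_iterate_cons k a v]
    exact (BinomEquiv.refl _).append ih
  | swap a b l =>
    rw [tm_iterate_cons k b (a :: l), tm_iterate_cons k a l, tm_iterate_cons k a (b :: l),
      tm_iterate_cons k b l, ← List.append_assoc, ← List.append_assoc]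
    exact (binomEquiv_tm_iterate_singleton k b a).append_comm.append (BinomEquiv.refl _)
  | trans _ _ ih ih' => exact ih.trans ih'

theorem binomEquiv_tm_iterate_of_count_eq (k : ℕ) {u v : List (Fin 2)}
    (hl : u.length = v.length) (h : u.count 1 = v.count 1) :
    BinomEquiv (k + 1) (tm^[k] u) (tm^[k] v) :=
  binomEquiv_tm_iterate_of_perm k (perm_of_count_one_eq hl h)

theorem binom_singleton_one (u : List (Fin 2)) : binom u [1] = u.count 1 := by
  induction u with
  | nil => exact binom_nil_cons _ _
  | cons a u ih => rw [binom_cons_cons, ih, binom_nil_right, List.count_cons]; simp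

theorem BinomEquiv.count_one_eq {k : ℕ} {u v : List (Fin 2)} (h : BinomEquiv (k + 1) u v) :
    u.count 1 = v.count 1 := by
  rw [← binom_singleton_one, ← binom_singleton_one]
  exact h _ (Nat.succ_le_succ (Nat.zero_le k))

/-- The sum of the positions (counted from zero) of the letters `1` in a binary word. -/
def onesPos : List (Fin 2) → ℕ
  | [] => 0
  | _ :: u => onesPos u + u.count 1

theorem binom_zero_one_add_binom_one_one (u : List (Fin 2)) :
    binom u [0, 1] + binom u [1, 1] = onesPos u := by
  induction u with
  | nil => simp [binom_nil_cons, onesPos]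
  | cons a u ih =>
    rw [binom_cons_cons, binom_cons_cons, binom_singleton_one, onesPos, ← ih]
    fin_cases a <;> simp <;> ring

end Images

section GenPoly

open Polynomial

/-- The polynomial whose `j`-th coefficient is the binomial coefficient of `u` and `1ʲ0`. -/
noncomputable def genPoly : List (Fin 2) → ℤ[X]
  | [] => 0
  | a :: u => (if a = 0 then 1 else 0) + (1 + X) ^ a.val * genPoly u

theorem coeff_genPoly (u : List (Fin 2)) (j : ℕ) :
    (genPoly u).coeff j = binom u (List.replicate j 1 ++ [0]) := by
  induction u generalizing j with
  | nil => cases j <;> simp [genPoly, List.replicate_succ, binom_nil_cons]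
  | cons a u ih =>
    cases j with
    | zero =>
      have hcoeff := ih 0
      rw [List.replicate_zero, List.nil_append] at hcoeff ⊢
      rw [binom_cons_cons, Nat.cast_add, ← hcoeff]
      fin_cases a <;> simp [genPoly, binom_nil_right, add_mul, add_comm]
    | succ j =>
      have hcoeff := ih (j + 1)
      rw [List.replicate_succ, List.cons_append] at hcoeff ⊢
      rw [binom_cons_cons, Nat.cast_add, ← hcoeff]
      fin_cases a
      · simp [genPoly, coeff_one]
      · simp [genPoly, add_mul, ih j]

theorem genPoly_append (u v : List (Fin 2)) :
    genPoly (u ++ v) = genPoly u + (1 + X) ^ u.count 1 * genPoly v := by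
  induction u with
  | nil => simp [genPoly]
  | cons a u ih =>
    rw [List.cons_append, genPoly, genPoly, ih, count_one_cons, pow_add]
    ring

theorem BinomEquiv.X_pow_dvd_genPoly_sub {k : ℕ} {u v : List (Fin 2)} (h : BinomEquiv k u v) :
    (X : ℤ[X]) ^ k ∣ genPoly u - genPoly v := by
  rw [X_pow_dvd_iff]
  intro d hd
  rw [coeff_sub, coeff_genPoly, coeff_genPoly, h _ (by simpa using hd), sub_self]

/-- The sum of the powers `rⁱ` over the positions `i` of the letters `1` of a binary word. -/
def onesSum {R : Type*} [CommSemiring R] (r : R) : List (Fin 2) → R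
  | [] => 0
  | a :: u => a.val + r * onesSum r u

theorem coeff_onesSum {R : Type*} [CommSemiring R] {r : R[X]} (hr : r.coeff 0 = 1)
    (u : List (Fin 2)) :
    (onesSum r u).coeff 0 = u.count 1 ∧ (onesSum r u).coeff 1 = r.coeff 1 * onesPos u := by
  induction u with
  | nil => simp [onesSum, onesPos]
  | cons a u ih =>
    have hcoeff_one : (a.val : R[X]).coeff 1 = 0 := by
      rw [← C_eq_natCast, coeff_C_succ]
    have hcoeff_zero : (a.val : R[X]).coeff 0 = a.val := by
      rw [← C_eq_natCast, coeff_C_zero]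
    rw [onesSum, coeff_add, coeff_add, mul_coeff_zero, mul_coeff_one, hr, ih.1, ih.2, hcoeff_zero,
      hcoeff_one, count_one_cons, onesPos]
    push_cast
    constructor <;> ring

theorem genPoly_tm_iterate_succ (k : ℕ) (u : List (Fin 2)) :
    genPoly (tm^[k + 1] u) =
      genPoly (tm^[k + 1] [0]) * ∑ i ∈ Finset.range u.length, ((1 + X) ^ 2 ^ k) ^ i +
      (genPoly (tm^[k + 1] [1]) - genPoly (tm^[k + 1] [0])) * onesSum ((1 + X) ^ 2 ^ k) u := by
  induction u with
  | nil => simp [onesSum, genPoly, Function.iterate_fixed (show tm [] = [] from rfl)]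
  | cons a u ih =>
    have hletter : genPoly (tm^[k + 1] [a]) = genPoly (tm^[k + 1] [0]) +
        (genPoly (tm^[k + 1] [1]) - genPoly (tm^[k + 1] [0])) * (a.val : ℤ[X]) := by
      fin_cases a <;> simp
    rw [tm_iterate_cons, genPoly_append, count_one_tm_iterate_succ, ih, hletter, onesSum,
      List.length_singleton, mul_one, List.length_cons, Finset.sum_range_succ']
    simp only [pow_succ _ (_ : ℕ), ← Finset.sum_mul, pow_zero]
    ring

theorem exists_genPoly_tm_iterate_succ_sub_eq (k : ℕ) :
    ∃ q : ℤ[X], q.coeff 0 ≠ 0 ∧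
      genPoly (tm^[k + 1] [1]) - genPoly (tm^[k + 1] [0]) = X ^ (k + 1) * q := by
  induction k with
  | zero => exact ⟨1, by simp, by simp [tm, tmLetter, genPoly]⟩
  | succ k ih =>
    obtain ⟨q, hq, hdiff⟩ := ih
    obtain ⟨p, hp⟩ : (X : ℤ[X]) ∣ 1 - (1 + X) ^ 2 ^ k := by
      simp [X_dvd_iff, coeff_one_add_X_pow]
    have hp_coeff : p.coeff 0 = -2 ^ k := by
      have h := congrArg (coeff · 1) hp
      simpa [coeff_one_add_X_pow, coeff_one, coeff_X_mul, eq_comm] using h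
    refine ⟨p * q, ?_, ?_⟩
    · rw [mul_coeff_zero, hp_coeff]
      exact mul_ne_zero (by simp) hq
    · calc genPoly (tm^[k + 2] [1]) - genPoly (tm^[k + 2] [0])
          = (1 - (1 + X) ^ 2 ^ k) *
              (genPoly (tm^[k + 1] [1]) - genPoly (tm^[k + 1] [0])) := by
            rw [tm_iterate_succ_singleton (k + 1), tm_iterate_succ_singleton (k + 1),
              genPoly_append, genPoly_append, count_one_tm_iterate_succ,
              count_one_tm_iterate_succ]
            simp only [List.length_singleton, mul_one, sub_self, sub_zero]
            ring
        _ = X ^ (k + 2) * (p * q) := by rw [hdiff, hp]; ring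

theorem onesPos_eq_of_binomEquiv_tm_iterate (k : ℕ) {u v : List (Fin 2)}
    (hl : u.length = v.length) (h : BinomEquiv (k + 2) (tm^[k] u) (tm^[k] v)) :
    onesPos u = onesPos v := by
  cases k with
  | zero =>
    rw [← binom_zero_one_add_binom_one_one, ← binom_zero_one_add_binom_one_one]
    exact congrArg₂ (· + ·) (h [0, 1] le_rfl) (h [1, 1] le_rfl)
  | succ k =>
    obtain ⟨q, hq, hdiff⟩ := exists_genPoly_tm_iterate_succ_sub_eq k
    set r : ℤ[X] := (1 + X) ^ 2 ^ k with hr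
    have hr_zero : r.coeff 0 = 1 := by simp [hr, coeff_one_add_X_pow]
    have hr_one : r.coeff 1 = 2 ^ k := by simp [hr, coeff_one_add_X_pow]
    have hdvd : X ^ (k + 1) * X ^ 2 ∣ X ^ (k + 1) * (q * (onesSum r u - onesSum r v)) := by
      have heq : genPoly (tm^[k + 1] u) - genPoly (tm^[k + 1] v) =
          X ^ (k + 1) * (q * (onesSum r u - onesSum r v)) := by
        rw [genPoly_tm_iterate_succ, genPoly_tm_iterate_succ k v, hdiff, hl]
        ring
      rw [← heq, ← pow_add]
      exact h.X_pow_dvd_genPoly_sub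
    have hdvd_sub : X ^ 2 ∣ onesSum r u - onesSum r v :=
      prime_X.pow_dvd_of_dvd_mul_left 2 (by rwa [X_dvd_iff])
        ((mul_dvd_mul_iff_left (pow_ne_zero _ X_ne_zero)).1 hdvd)
    have hcoeff := X_pow_dvd_iff.1 hdvd_sub 1 one_lt_two
    rw [coeff_sub, (coeff_onesSum hr_zero u).2, (coeff_onesSum hr_zero v).2, hr_one, ← mul_sub,
      mul_eq_zero, or_iff_right (by positivity), sub_eq_zero] at hcoeff
    exact_mod_cast hcoeff

end GenPoly

section Blocks

variable {α : Type*} (x : ℕ → α) (q q' m n : ℕ)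

theorem length_block : (block x q n).length = n := by
  simp [block]

theorem block_succ_left : block x q (n + 1) = x q :: block x (q + 1) n := by
  simp [block, List.ofFn_succ, add_assoc, add_comm 1]

theorem block_add : block x q (m + n) = block x q m ++ block x (q + m) n := by
  simp [block, List.ofFn_add, add_assoc]

theorem block_shift : block (fun j => x (q' + j)) q n = block x (q' + q) n := by
  simp [block, add_assoc]

variable {x q q' n}

theorem block_eq_iff : block x q n = block x q' n ↔ ∀ i < n, x (q + i) = x (q' + i) := by
  simp only [block, List.ofFn_inj, funext_iff, Fin.forall_iff]

theorem mem_block_iff {a : α} : a ∈ block x q n ↔ ∃ i < n, x (q + i) = a := by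
  simp [block, Fin.exists_iff]

end Blocks

section Weight

variable (x : ℕ → Fin 2) (q m n : ℕ)

/-- The number of letters `1` in the factor of length `n` of `x` at position `q`. -/
def weight : ℕ := (block x q n).count 1

/-- The sum of the positions, counted from `q`, of the letters `1` in the factor of length `n` of
`x` at position `q`. -/
def posSum : ℕ := onesPos (block x q n)

theorem weight_zero : weight x q 0 = 0 := rfl

theorem weight_succ_left : weight x q (n + 1) = (x q).val + weight x (q + 1) n := by
  rw [weight, block_succ_left, count_one_cons, weight]

theorem weight_one : weight x q 1 = (x q).val := by
  rw [weight_succ_left, weight_zero, add_zero]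

theorem weight_add : weight x q (m + n) = weight x q m + weight x (q + m) n := by
  rw [weight, block_add, List.count_append, weight, weight]

theorem weight_succ_right : weight x q (n + 1) = weight x q n + (x (q + n)).val := by
  rw [weight_add, weight_one]

theorem weight_le : weight x q n ≤ n :=
  List.count_le_length.trans_eq (length_block x q n)

theorem onesPos_append (u v : List (Fin 2)) :
    onesPos (u ++ v) = onesPos u + onesPos v + u.length * v.count 1 := by
  induction u with
  | nil => simp [onesPos]
  | cons a u ih =>
    rw [List.cons_append, onesPos, onesPos, ih, List.count_append, List.length_cons]
    ring

theorem posSum_add :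
    posSum x q (m + n) = posSum x q m + posSum x (q + m) n + m * weight x (q + m) n := by
  rw [posSum, block_add, onesPos_append, length_block, posSum, posSum, weight]

variable {x q n}

theorem eq_zero_of_weight_eq_zero (h : weight x q n = 0) {i : ℕ} (hi : i < n) :
    x (q + i) = 0 := by
  have hne : x (q + i) ≠ 1 := fun h1 => List.count_eq_zero.1 h (mem_block_iff.2 ⟨i, hi, h1⟩)
  omega

theorem eq_one_of_weight_eq (h : weight x q n = n) {i : ℕ} (hi : i < n) : x (q + i) = 1 :=
  (List.count_eq_length.1 (h.trans (length_block x q n).symm) _ (mem_block_iff.2 ⟨i, hi, rfl⟩)).symm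

theorem weight_of_le_one (h : n ≤ 1) : weight x q n = n * (x q).val := by
  interval_cases n
  · simp [weight_zero]
  · simp [weight_one]

theorem posSum_of_le_one (h : n ≤ 1) : posSum x q n = 0 := by
  interval_cases n <;> rfl

end Weight

section Image

theorem onesPos_tm (u : List (Fin 2)) : onesPos (tm u) + u.count 1 = u.length ^ 2 := by
  induction u with
  | nil => rfl
  | cons a u ih =>
    have hletter : onesPos (tmLetter a) + a.val = 1 := by
      fin_cases a <;> rfl
    rw [tm_cons, onesPos_append, count_one_tm, count_one_cons, List.length_cons, length_tmLetter]
    linarith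

variable (y : ℕ → Fin 2)

theorem val_one_sub (a : Fin 2) : (1 - a).val + a.val = 1 := by
  fin_cases a <;> rfl

theorem tmInf_even (h : ℕ) : tmInf y (2 * h) = y h := by
  have hletter : ∀ a, (tmLetter a).getD 0 0 = a := by decide
  rw [tmInf, Nat.mul_div_cancel_left _ two_pos, Nat.mul_mod_right, hletter]

theorem tmInf_odd (h : ℕ) : tmInf y (2 * h + 1) = 1 - y h := by
  have hletter : ∀ a, (tmLetter a).getD 1 0 = 1 - a := by decide
  rw [tmInf, Nat.mul_add_div two_pos, Nat.mul_add_mod, Nat.div_eq_of_lt one_lt_two, add_zero,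
    Nat.mod_eq_of_lt one_lt_two, hletter]

theorem tmInf_iterate_shift (k h i : ℕ) :
    tmInf^[k] (fun j => y (h + j)) i = tmInf^[k] y (2 ^ k * h + i) := by
  induction k generalizing i with
  | zero => simp
  | succ k ih =>
    have hdiv : (2 ^ (k + 1) * h + i) / 2 = 2 ^ k * h + i / 2 := by rw [pow_succ', mul_assoc]; omega
    have hmod : (2 ^ (k + 1) * h + i) % 2 = i % 2 := by rw [pow_succ', mul_assoc]; omega
    rw [Function.iterate_succ_apply', Function.iterate_succ_apply', tmInf, tmInf, ih, hdiv, hmod]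

theorem block_tmInf_iterate (k h n : ℕ) :
    block (tmInf^[k] y) (2 ^ k * h) (2 ^ k * n) = tm^[k] (block y h n) := by
  have hprefix : ∀ x, block (tmInf^[k] x) 0 (2 ^ k * n) = tm^[k] (block x 0 n) := by
    intro x
    induction k with
    | zero => simp
    | succ k ih =>
      rw [Function.iterate_succ_apply', Function.iterate_succ_apply', ← ih, ← block_tmInf,
        pow_succ', mul_assoc]
  have h0 := hprefix fun j => y (h + j)
  rwa [funext (tmInf_iterate_shift y k h), block_shift, block_shift, add_zero, add_zero] at h0

theorem block_tmInf_iterate_congr {y : ℕ → Fin 2} {k h h' i l : ℕ} (hil : i + l ≤ 2 ^ k)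
    (hy : y h = y h') :
    block (tmInf^[k] y) (2 ^ k * h + i) l = block (tmInf^[k] y) (2 ^ k * h' + i) l := by
  have hletter : ∀ j, block (tmInf^[k] y) (2 ^ k * j) (2 ^ k) = tm^[k] [y j] := fun j => by
    simpa [block] using block_tmInf_iterate y k j 1
  have hblock := (hletter h).trans (hy ▸ (hletter h').symm)
  rw [block_eq_iff] at hblock ⊢
  exact fun j hj => by simpa only [add_assoc] using hblock (i + j) (by omega)

theorem weight_tmInf_two_mul (g m : ℕ) : weight (tmInf y) (2 * g) (2 * m) = m := by
  have h := block_tmInf_iterate y 1 g m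
  rw [pow_one, Function.iterate_one, Function.iterate_one] at h
  rw [weight, h, count_one_tm, length_block]

theorem posSum_tmInf_two_mul (g m : ℕ) :
    posSum (tmInf y) (2 * g) (2 * m) + weight y g m = m ^ 2 := by
  have h := block_tmInf_iterate y 1 g m
  rw [pow_one, Function.iterate_one, Function.iterate_one] at h
  rw [posSum, h, weight, onesPos_tm, length_block]

variable {y} {g e L d m : ℕ}

theorem weight_tmInf_suffix (hd : d ≤ 1) (hL : e + L + d = 2 * (m + 1)) :
    weight (tmInf y) (2 * g + e + L) d = d * (1 - y (g + m)).val := by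
  rw [weight_of_le_one hd]
  obtain rfl | rfl : d = 0 ∨ d = 1 := by omega
  · rw [zero_mul, zero_mul]
  · rw [show 2 * g + e + L = 2 * (g + m) + 1 by omega, tmInf_odd]

theorem weight_tmInf_window (he : e ≤ 1) (hd : d ≤ 1) (hL : e + L + d = 2 * (m + 1)) :
    weight (tmInf y) (2 * g + e) L + e * (y g).val + d * (1 - y (g + m)).val = m + 1 := by
  have htotal := weight_tmInf_two_mul y g (m + 1)
  rw [← hL, weight_add, weight_add, ← add_assoc, weight_tmInf_suffix hd hL, weight_of_le_one he,
    tmInf_even] at htotal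
  linarith

theorem posSum_tmInf_window (he : e ≤ 1) (hd : d ≤ 1) (hL : e + L + d = 2 * (m + 1)) :
    posSum (tmInf y) (2 * g + e) L + weight y g (m + 1) + e * weight (tmInf y) (2 * g + e) L +
      d * (2 * m + 1) * (1 - y (g + m)).val = (m + 1) ^ 2 := by
  have htotal := posSum_tmInf_two_mul y g (m + 1)
  rw [← hL, posSum_add, posSum_add, ← add_assoc (2 * g), weight_tmInf_suffix hd hL,
    posSum_of_le_one he, posSum_of_le_one hd] at htotal
  have hlength : (e + L) * d = d * (2 * m + 1) := by
    obtain rfl | rfl : d = 0 ∨ d = 1 := by omega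
    · simp
    · rw [show e + L = 2 * m + 1 by omega]; ring
  rw [← hlength]
  linarith

end Image

section Parsing

/-- The word `y` contains no cube of a letter. -/
def CubeFree (y : ℕ → Fin 2) : Prop := ∀ i, y i = y (i + 1) → y (i + 1) ≠ y (i + 2)

theorem cubeFree_tmInf (y : ℕ → Fin 2) : CubeFree (tmInf y) := by
  have hpair : ∀ m, tmInf y (2 * m) ≠ tmInf y (2 * m + 1) := fun m h => by
    have := val_one_sub (y m)
    rw [tmInf_even, tmInf_odd] at h
    omega
  intro i h h'
  obtain ⟨m, rfl | rfl⟩ := Nat.even_or_odd' i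
  · exact hpair m h
  · exact hpair (m + 1) h'

/-- A window of length `n` in a word that is cut into blocks of length `N` meets `m + 1`
consecutive blocks; it omits the first `r` letters of the first one and the last `s` letters of
the last one. -/
structure IsCover (N n m r s : ℕ) : Prop where
  left_lt : r < N
  right_lt : s < N
  add_eq : r + n + s = N * (m + 1)

/-- The windows of an image of `y`, cut into images of letters, that are described by
`IsCover N n m r s` and whose first blocks are the images of the letters of `y` at `h` and at `h'`
come from factors of `y` with the same weight, and the same first and last letters if the images
of these letters are not contained in the windows. -/
structure SameCover (m r s : ℕ) (y : ℕ → Fin 2) (h h' : ℕ) : Prop where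
  weight_eq : weight y h (m + 1) = weight y h' (m + 1)
  left_eq : r ≠ 0 → y h = y h'
  right_eq : s ≠ 0 → y (h + m) = y (h' + m)

theorem IsCover.exists_of_lt {N n r : ℕ} (hn : 0 < n) (hr : r < N) :
    ∃ m s, IsCover N n m r s := by
  have hN : 0 < N := by omega
  have hdiv := Nat.div_add_mod (r + n - 1) N
  have hmod := Nat.mod_lt (r + n - 1) hN
  exact ⟨(r + n - 1) / N, N - 1 - (r + n - 1) % N, hr, by omega, by rw [mul_add]; omega⟩

theorem IsCover.split {N n m r s : ℕ} (h : IsCover (2 * N) n m r s) (hn : 0 < n) :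
    ∃ e d M r₀ s₀, e ≤ 1 ∧ d ≤ 1 ∧ e + (M + 1) + d = 2 * (m + 1) ∧ r = N * e + r₀ ∧
      s = N * d + s₀ ∧ IsCover N n M r₀ s₀ := by
  obtain ⟨hr, hs, hlen⟩ := h
  have hN : 0 < N := by omega
  have hsplit : ∀ t < 2 * N, ∃ e t₀, e ≤ 1 ∧ t = N * e + t₀ ∧ t₀ < N := fun t ht =>
    ⟨t / N, t % N, Nat.le_of_lt_succ (Nat.div_lt_of_lt_mul (by rwa [mul_comm])),
      (Nat.div_add_mod t N).symm, Nat.mod_lt t hN⟩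
  obtain ⟨e, r₀, he, rfl, hr₀⟩ := hsplit r hr
  obtain ⟨d, s₀, hd, rfl, hs₀⟩ := hsplit s hs
  obtain ⟨M, hM⟩ : ∃ M, e + (M + 1) + d = 2 * (m + 1) := by
    refine ⟨2 * m + 1 - e - d, ?_⟩
    have hcut : N * (e + d) < N * (2 * (m + 1)) := by linarith
    have := lt_of_mul_lt_mul_left hcut (Nat.zero_le N)
    omega
  refine ⟨e, d, M, r₀, s₀, he, hd, hM, rfl, rfl, hr₀, hs₀, ?_⟩
  have : N * (e + (M + 1) + d) = 2 * N * (m + 1) := by rw [hM]; ring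
  simp only [mul_add] at this hlen ⊢
  omega

theorem IsCover.unique {N n m m' r s s' : ℕ} (h : IsCover N n m r s) (h' : IsCover N n m' r s') :
    m = m' ∧ s = s' := by
  have hle : ∀ {m m' s s'}, IsCover N n m r s → IsCover N n m' r s' → m ≤ m' := by
    intro m m' s s' h h'
    have hlt : N * (m + 1) < N * (m' + 2) := by linarith [h.add_eq, h'.add_eq, h.right_lt]
    have := lt_of_mul_lt_mul_left hlt (Nat.zero_le N)
    omega
  obtain rfl := le_antisymm (hle h h') (hle h' h)
  exact ⟨rfl, by linarith [h.add_eq, h'.add_eq]⟩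

theorem SameCover.comp {N M m r s e d g g' : ℕ} {y : ℕ → Fin 2} (hm : e + (M + 1) + d = 2 * (m + 1))
    (h : SameCover M r s (tmInf y) (2 * g + e) (2 * g' + e)) (h' : SameCover m e d y g g') :
    SameCover m (N * e + r) (N * d + s) y g g' where
  weight_eq := h'.weight_eq
  left_eq hr := by
    rcases Nat.eq_zero_or_pos e with rfl | he
    · simpa only [add_zero, tmInf_even] using h.left_eq (by simpa using hr)
    · exact h'.left_eq he.ne'
  right_eq hs := by
    rcases Nat.eq_zero_or_pos d with rfl | hd
    · have hlast := h.right_eq (by simpa using hs)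
      rwa [show 2 * g + e + M = 2 * (g + m) + 1 by omega,
        show 2 * g' + e + M = 2 * (g' + m) + 1 by omega, tmInf_odd, tmInf_odd,
        sub_right_inj] at hlast
    · exact h'.right_eq hd.ne'

variable {y : ℕ → Fin 2} {g g' e e' d d' L m m' : ℕ}

theorem sameCover_of_weight_eq_of_posSum_eq (he : e ≤ 1) (hd : d ≤ 1)
    (hL : e + L + d = 2 * (m + 1)) (hm : 1 ≤ m)
    (hweight : weight (tmInf y) (2 * g + e) L = weight (tmInf y) (2 * g' + e) L)
    (hpos : posSum (tmInf y) (2 * g + e) L = posSum (tmInf y) (2 * g' + e) L) :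
    SameCover m e d y g g' := by
  have w := weight_tmInf_window (y := y) (g := g) he hd hL
  have w' := weight_tmInf_window (y := y) (g := g') he hd hL
  have p := posSum_tmInf_window (y := y) (g := g) he hd hL
  have p' := posSum_tmInf_window (y := y) (g := g') he hd hL
  rw [hweight] at w p
  rw [hpos] at p
  have hle := weight_le y g (m + 1)
  have hle' := weight_le y g' (m + 1)
  have b := val_one_sub (y (g + m))
  have b' := val_one_sub (y (g' + m))
  have hlast : d ≠ 0 → (y (g + m)).val = (y (g' + m)).val := by
    intro h0
    obtain rfl : d = 1 := by omega
    rcases Nat.lt_trichotomy (1 - y (g + m)).val (1 - y (g' + m)).val with h | h | h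
    · rw [show (1 - y (g + m)).val = 0 by omega] at p
      rw [show (1 - y (g' + m)).val = 1 by omega] at p'
      omega
    · omega
    · rw [show (1 - y (g + m)).val = 1 by omega] at p
      rw [show (1 - y (g' + m)).val = 0 by omega] at p'
      omega
  have hlast_mul : d * (1 - y (g + m)).val = d * (1 - y (g' + m)).val := by
    rcases Nat.eq_zero_or_pos d with rfl | h0
    · simp only [zero_mul]
    · rw [show (1 - y (g + m)).val = (1 - y (g' + m)).val by have := hlast h0.ne'; omega]
  refine ⟨?_, fun h0 => ?_, fun h0 => Fin.ext (hlast h0)⟩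
  · rw [mul_right_comm, hlast_mul, ← mul_right_comm] at p
    omega
  · obtain rfl : e = 1 := by omega
    exact Fin.ext (by omega)

theorem weight_eq_of_misaligned (hL : 0 + L + d = 2 * (m + 1)) (hL' : 1 + L + d' = 2 * (m' + 1))
    (hd : d ≤ 1) (hd' : d' ≤ 1)
    (hweight : weight (tmInf y) (2 * g + 0) L = weight (tmInf y) (2 * g' + 1) L)
    (hpos : posSum (tmInf y) (2 * g + 0) L = posSum (tmInf y) (2 * g' + 1) L) :
    (weight y g (m + 1) = m + 1 ∧ weight y g' (m' + 1) = 0) ∨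
      (weight y g (m + 1) = 0 ∧ weight y g' (m' + 1) = m' + 1) := by
  have w := weight_tmInf_window (y := y) (g := g) zero_le_one hd hL
  have w' := weight_tmInf_window (y := y) (g := g') le_rfl hd' hL'
  have p := posSum_tmInf_window (y := y) (g := g) zero_le_one hd hL
  have p' := posSum_tmInf_window (y := y) (g := g') le_rfl hd' hL'
  have hle := weight_le y g (m + 1)
  have hle' := weight_le y g' (m' + 1)
  rw [hweight] at w
  rw [hpos] at p
  obtain rfl | rfl : d = 0 ∨ d = 1 := by omega
  · obtain rfl : d' = 1 := by omega
    obtain rfl : m' = m + 1 := by omega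
    obtain hb | hb : (1 - y (g' + (m + 1))).val = 0 ∨ (1 - y (g' + (m + 1))).val = 1 := by omega
    · rw [hb] at w' p'
      exact Or.inr (by constructor <;> linarith)
    · rw [hb] at w' p'
      exact Or.inl (by constructor <;> linarith)
  · obtain rfl : d' = 0 := by omega
    obtain rfl : m' = m := by omega
    obtain hb | hb : (1 - y (g + m')).val = 0 ∨ (1 - y (g + m')).val = 1 := by omega
    · rw [hb] at w p
      exact Or.inl (by constructor <;> linarith)
    · rw [hb] at w p
      exact Or.inr (by constructor <;> linarith)

theorem exists_const_of_misaligned (hL : 0 + L + d = 2 * (m + 1))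
    (hL' : 1 + L + d' = 2 * (m' + 1)) (hd : d ≤ 1) (hd' : d' ≤ 1)
    (hweight : weight (tmInf y) (2 * g + 0) L = weight (tmInf y) (2 * g' + 1) L)
    (hpos : posSum (tmInf y) (2 * g + 0) L = posSum (tmInf y) (2 * g' + 1) L) :
    ∃ c, (∀ i < m + 1, y (g + i) = c) ∧ ∀ i < m' + 1, y (g' + i) = 1 - c := by
  rcases weight_eq_of_misaligned hL hL' hd hd' hweight hpos with ⟨h, h'⟩ | ⟨h, h'⟩
  · exact ⟨1, fun i => eq_one_of_weight_eq h, fun i => eq_zero_of_weight_eq_zero h'⟩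
  · exact ⟨0, fun i => eq_zero_of_weight_eq_zero h, fun i => eq_one_of_weight_eq h'⟩

theorem block_tmInf_eq_of_const {c : Fin 2} (hL : L ≤ 2 * (m + 1)) (hL' : 1 + L ≤ 2 * (m' + 1))
    (h : ∀ i < m + 1, y (g + i) = c) (h' : ∀ i < m' + 1, y (g' + i) = 1 - c) :
    block (tmInf y) (2 * g + 0) L = block (tmInf y) (2 * g' + 1) L := by
  rw [block_eq_iff]
  intro i hi
  obtain ⟨j, rfl | rfl⟩ := Nat.even_or_odd' i
  · rw [show 2 * g + 0 + 2 * j = 2 * (g + j) by ring,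
      show 2 * g' + 1 + 2 * j = 2 * (g' + j) + 1 by ring, tmInf_even, tmInf_odd, h j (by omega),
      h' j (by omega), sub_sub_cancel]
  · rw [show 2 * g + 0 + (2 * j + 1) = 2 * (g + j) + 1 by ring,
      show 2 * g' + 1 + (2 * j + 1) = 2 * (g' + (j + 1)) by ring, tmInf_even, tmInf_odd,
      h j (by omega), h' (j + 1) (by omega)]

theorem not_cubeFree_of_const {c : Fin 2} (hm : 2 ≤ m) (h : ∀ i < m + 1, y (g + i) = c) :
    ¬ CubeFree y := fun hy =>
  hy g ((h 0 (by omega)).trans (h 1 (by omega)).symm)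
    ((h 1 (by omega)).trans (h 2 (by omega)).symm)

theorem sameCover_or_block_eq (he : e ≤ 1) (hd : d ≤ 1) (he' : e' ≤ 1) (hd' : d' ≤ 1)
    (hL : e + L + d = 2 * (m + 1)) (hL' : e' + L + d' = 2 * (m' + 1)) (hL_four : 4 ≤ L)
    (hweight : weight (tmInf y) (2 * g + e) L = weight (tmInf y) (2 * g' + e') L)
    (hpos : posSum (tmInf y) (2 * g + e) L = posSum (tmInf y) (2 * g' + e') L) :
    (e = e' ∧ SameCover m e d y g g') ∨
      (block (tmInf y) (2 * g + e) L = block (tmInf y) (2 * g' + e') L ∧ ¬ CubeFree y) := by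
  obtain rfl | hne := eq_or_ne e e'
  · exact Or.inl
      ⟨rfl, sameCover_of_weight_eq_of_posSum_eq he hd hL (by omega) hweight hpos⟩
  · right
    obtain ⟨rfl, rfl⟩ | ⟨rfl, rfl⟩ : (e = 0 ∧ e' = 1) ∨ (e = 1 ∧ e' = 0) := by omega
    · obtain ⟨c, h, h'⟩ := exists_const_of_misaligned hL hL' hd hd' hweight hpos
      exact ⟨block_tmInf_eq_of_const (by omega) (by omega) h h',
        not_cubeFree_of_const (by omega) h'⟩
    · obtain ⟨c, h, h'⟩ := exists_const_of_misaligned hL' hL hd' hd hweight.symm hpos.symm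
      exact ⟨(block_tmInf_eq_of_const (by omega) (by omega) h h').symm,
        not_cubeFree_of_const (by omega) h'⟩

end Parsing

section Factors

variable {k n m m' r r' s s' h h' K : ℕ} {y : ℕ → Fin 2}

theorem IsCover.tm_iterate_block (hc : IsCover (2 ^ k) n m r s) (y : ℕ → Fin 2) (h : ℕ) :
    tm^[k] (block y h (m + 1)) = block (tmInf^[k] y) (2 ^ k * h + 0) r ++
      block (tmInf^[k] y) (2 ^ k * h + r) n ++
        block (tmInf^[k] y) (2 ^ k * (h + m) + (2 ^ k - s)) s := by
  obtain ⟨-, hs, hlen⟩ := hc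
  have hpos : 2 ^ k * (h + m) + (2 ^ k - s) = 2 ^ k * h + r + n := by
    simp only [mul_add] at hlen ⊢
    omega
  rw [← block_tmInf_iterate, ← hlen, block_add, block_add, hpos, add_zero, ← add_assoc]

theorem binomEquiv_block_tmInf_iterate_iff (hc : IsCover (2 ^ k) n m r s)
    (hleft : r ≠ 0 → y h = y h') (hright : s ≠ 0 → y (h + m) = y (h' + m)) :
    BinomEquiv K (block (tmInf^[k] y) (2 ^ k * h + r) n)
      (block (tmInf^[k] y) (2 ^ k * h' + r) n) ↔
      BinomEquiv K (tm^[k] (block y h (m + 1))) (tm^[k] (block y h' (m + 1))) := by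
  have hprefix :
      block (tmInf^[k] y) (2 ^ k * h + 0) r = block (tmInf^[k] y) (2 ^ k * h' + 0) r := by
    rcases Nat.eq_zero_or_pos r with rfl | hr
    · rfl
    · exact block_tmInf_iterate_congr (by have := hc.left_lt; omega) (hleft hr.ne')
  have hsuffix : block (tmInf^[k] y) (2 ^ k * (h + m) + (2 ^ k - s)) s =
      block (tmInf^[k] y) (2 ^ k * (h' + m) + (2 ^ k - s)) s := by
    rcases Nat.eq_zero_or_pos s with rfl | hs
    · rfl
    · exact block_tmInf_iterate_congr (by have := hc.right_lt; omega) (hright hs.ne')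
  rw [hc.tm_iterate_block, hc.tm_iterate_block, hprefix, hsuffix, binomEquiv_append_append_iff]

theorem SameCover.binomEquiv (hs : SameCover m r s y h h') (hc : IsCover (2 ^ k) n m r s) :
    BinomEquiv (k + 1) (block (tmInf^[k] y) (2 ^ k * h + r) n)
      (block (tmInf^[k] y) (2 ^ k * h' + r) n) := by
  rw [binomEquiv_block_tmInf_iterate_iff hc hs.left_eq hs.right_eq]
  exact binomEquiv_tm_iterate_of_count_eq k (by rw [length_block, length_block]) hs.weight_eq

theorem SameCover.posSum_eq (hs : SameCover m r s y h h') (hc : IsCover (2 ^ k) n m r s)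
    (hb : BinomEquiv (k + 2) (block (tmInf^[k] y) (2 ^ k * h + r) n)
      (block (tmInf^[k] y) (2 ^ k * h' + r) n)) :
    posSum y h (m + 1) = posSum y h' (m + 1) :=
  onesPos_eq_of_binomEquiv_tm_iterate k (by rw [length_block, length_block])
    ((binomEquiv_block_tmInf_iterate_iff hc hs.left_eq hs.right_eq).1 hb)

theorem IsCover.four_le {N : ℕ} (hc : IsCover N n m r s) (hn : 4 * N ≤ n) : 4 ≤ m + 1 := by
  have hle : N * 4 ≤ N * (m + 1) := by linarith [hc.add_eq]
  exact le_of_mul_le_mul_left hle (by have := hc.left_lt; omega)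

theorem tmInf_iterate_succ_index (k h e r : ℕ) :
    2 ^ (k + 1) * h + (2 ^ k * e + r) = 2 ^ k * (2 * h + e) + r := by
  ring

theorem sameCover_of_binomEquiv (k : ℕ) {n m m' r r' s s' h h' : ℕ} {y : ℕ → Fin 2}
    (hy : CubeFree y) (hn : 2 * 2 ^ k ≤ n) (hc : IsCover (2 ^ k) n m r s)
    (hc' : IsCover (2 ^ k) n m' r' s')
    (hb : BinomEquiv (k + 1) (block (tmInf^[k] y) (2 ^ k * h + r) n)
      (block (tmInf^[k] y) (2 ^ k * h' + r') n)) :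
    r = r' ∧ SameCover m r s y h h' := by
  induction k generalizing y m m' r r' s s' h h' with
  | zero =>
    obtain ⟨hr, hs, hlen⟩ := hc
    obtain ⟨hr', hs', -⟩ := hc'
    obtain ⟨rfl, rfl, rfl, rfl⟩ : r = 0 ∧ s = 0 ∧ r' = 0 ∧ s' = 0 := by omega
    obtain rfl : n = m + 1 := by omega
    have hweight := hb.count_one_eq
    simp only [Function.iterate_zero, id_eq, pow_zero, one_mul, add_zero] at hweight
    exact ⟨rfl, hweight, absurd rfl, absurd rfl⟩
  | succ k ih =>
    have hN := Nat.two_pow_pos k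
    rw [pow_succ'] at hn hc hc'
    obtain ⟨e, d, M, r₀, s₀, he, hd, hM, rfl, rfl, hc₀⟩ := hc.split (by omega)
    obtain ⟨e', d', M', r₀', s₀', he', hd', hM', rfl, rfl, hc₀'⟩ := hc'.split (by omega)
    rw [tmInf_iterate_succ_index, tmInf_iterate_succ_index, Function.iterate_succ_apply] at hb
    obtain ⟨rfl, hs₀⟩ := ih (cubeFree_tmInf y) (by omega) hc₀ hc₀' (hb.mono (by omega))
    obtain ⟨rfl, rfl⟩ := hc₀.unique hc₀'
    obtain ⟨rfl, hs⟩ | ⟨-, hcube⟩ := sameCover_or_block_eq he hd he' hd' hM hM'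
      (hc₀.four_le (by omega)) hs₀.weight_eq (hs₀.posSum_eq hc₀ hb)
    · exact ⟨rfl, hs₀.comp hM hs⟩
    · exact absurd hy hcube

theorem binomEquiv_iff_sameCover (hy : CubeFree y) (hn : 2 * 2 ^ k ≤ n)
    (hc : IsCover (2 ^ k) n m r s) (hc' : IsCover (2 ^ k) n m' r' s') :
    BinomEquiv (k + 1) (block (tmInf^[k] y) (2 ^ k * h + r) n)
      (block (tmInf^[k] y) (2 ^ k * h' + r') n) ↔ r = r' ∧ SameCover m r s y h h' := by
  refine ⟨sameCover_of_binomEquiv k hy hn hc hc', ?_⟩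
  rintro ⟨rfl, hs⟩
  exact hs.binomEquiv hc

theorem binomEquiv_of_sameCover_of_posSum_eq (hn : 4 * 2 ^ k ≤ n) (hc : IsCover (2 ^ k) n m r s)
    (hs : SameCover m r s (tmInf y) h h')
    (hpos : posSum (tmInf y) h (m + 1) = posSum (tmInf y) h' (m + 1)) :
    BinomEquiv (k + 2) (block (tmInf^[k] (tmInf y)) (2 ^ k * h + r) n)
      (block (tmInf^[k] (tmInf y)) (2 ^ k * h' + r) n) := by
  have hcover : ∀ h, ∃ g e p d, h = 2 * g + e ∧ e ≤ 1 ∧ d ≤ 1 ∧ e + (m + 1) + d = 2 * (p + 1) :=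
    fun h => ⟨h / 2, h % 2, (m + h % 2) / 2, 1 - (m + h % 2) % 2, by omega⟩
  obtain ⟨g, e, p, d, rfl, he, hd, hL⟩ := hcover h
  obtain ⟨g', e', p', d', rfl, he', hd', hL'⟩ := hcover h'
  obtain ⟨rfl, hs'⟩ | ⟨hblock, -⟩ := sameCover_or_block_eq he hd he' hd' hL hL' (hc.four_le hn)
    hs.weight_eq hpos
  · have hcomp : IsCover (2 ^ (k + 1)) n p (2 ^ k * e + r) (2 ^ k * d + s) := by
      obtain ⟨hr, hs, hlen⟩ := hc
      have hlt : ∀ {e r}, e ≤ 1 → r < 2 ^ k → 2 ^ k * e + r < 2 ^ (k + 1) := by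
        intro e r he hr
        have := Nat.mul_le_mul_left (2 ^ k) he
        omega
      have htotal : 2 ^ k * (e + (m + 1) + d) = 2 ^ (k + 1) * (p + 1) := by rw [hL]; ring
      refine ⟨hlt he hr, hlt hd hs, ?_⟩
      linarith [mul_add (2 ^ k) (e + (m + 1)) d, mul_add (2 ^ k) e (m + 1)]
    rw [← tmInf_iterate_succ_index, ← tmInf_iterate_succ_index, ← Function.iterate_succ_apply]
    exact (hs.comp hL hs').binomEquiv hcomp
  · rw [binomEquiv_block_tmInf_iterate_iff hc hs.left_eq hs.right_eq, hblock]
    exact BinomEquiv.refl _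

theorem binomEquiv_tmInf_iff (hn : 4 * 2 ^ k ≤ n) (hc : IsCover (2 ^ k) n m r s)
    (hc' : IsCover (2 ^ k) n m' r' s') :
    BinomEquiv (k + 2) (block (tmInf^[k] (tmInf y)) (2 ^ k * h + r) n)
      (block (tmInf^[k] (tmInf y)) (2 ^ k * h' + r') n) ↔
      r = r' ∧ SameCover m r s (tmInf y) h h' ∧
        posSum (tmInf y) h (m + 1) = posSum (tmInf y) h' (m + 1) := by
  constructor
  · intro hb
    obtain ⟨rfl, hs⟩ := sameCover_of_binomEquiv k (cubeFree_tmInf y) (by omega) hc hc'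
      (hb.mono (by omega))
    exact ⟨rfl, hs, hs.posSum_eq hc hb⟩
  · rintro ⟨rfl, hs, hpos⟩
    exact binomEquiv_of_sameCover_of_posSum_eq hn hc hs hpos

end Factors

section Counting

theorem ncard_range_congr {ι α β : Type*} {f : ι → α} {g : ι → β}
    (h : ∀ i j, f i = f j ↔ g i = g j) : (Set.range f).ncard = (Set.range g).ncard :=
  Nat.card_congr ((Setoid.quotientKerEquivRange f).symm.trans
    ((Quotient.congrRight fun i j => h i j).trans (Setoid.quotientKerEquivRange g)))

theorem ncard_range_eq_sum_mod {α : Type*} {f : ℕ → α} {N : ℕ} (hN : 0 < N)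
    (hf : (Set.range f).Finite) (h : ∀ q q', f q = f q' → q % N = q' % N) :
    (Set.range f).ncard = ∑ r ∈ Finset.range N, (Set.range fun h => f (N * h + r)).ncard := by
  classical
  have hfin : ∀ r, (Set.range fun h => f (N * h + r)).Finite := fun r =>
    hf.subset (Set.range_subset_iff.2 fun h => ⟨_, rfl⟩)
  have hunion : hf.toFinset = (Finset.range N).biUnion fun r => (hfin r).toFinset := by
    ext a
    simp only [Set.Finite.mem_toFinset, Finset.mem_biUnion, Set.mem_range, Finset.mem_range]
    constructor
    · rintro ⟨q, rfl⟩
      exact ⟨q % N, Nat.mod_lt _ hN, q / N, by rw [Nat.div_add_mod]⟩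
    · rintro ⟨r, -, q, rfl⟩
      exact ⟨_, rfl⟩
  rw [Set.ncard_eq_toFinset_card _ hf, hunion, Finset.card_biUnion]
  · exact Finset.sum_congr rfl fun r _ => (Set.ncard_eq_toFinset_card _ (hfin r)).symm
  · intro r hr r' hr' hne
    rw [Finset.mem_coe, Finset.mem_range] at hr hr'
    rw [Function.onFun, Finset.disjoint_left]
    simp only [Set.Finite.mem_toFinset, Set.mem_range]
    rintro _ ⟨q, rfl⟩ ⟨q', hq'⟩
    have hmod := h _ _ hq'
    rw [Nat.mul_add_mod, Nat.mul_add_mod, Nat.mod_eq_of_lt hr, Nat.mod_eq_of_lt hr'] at hmod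
    exact hne hmod.symm

theorem sum_range_eq_of_pos {N a : ℕ} {f : ℕ → ℕ} (hN : 0 < N)
    (h : ∀ r, r ≠ 0 → r < N → f r = a) : ∑ r ∈ Finset.range N, f r = f 0 + (N - 1) * a := by
  obtain ⟨M, rfl⟩ := Nat.exists_eq_add_of_lt hN
  rw [Finset.sum_range_succ', Finset.sum_congr rfl fun r hr =>
    h (r + 1) r.succ_ne_zero (by rw [Finset.mem_range] at hr; omega), Finset.sum_const,
    Finset.card_range, smul_eq_mul, add_comm, Nat.add_sub_cancel]

theorem sum_range_eq_of_pos_of_lt {N a : ℕ} {f : ℕ → ℕ} (hN : 2 ≤ N)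
    (h : ∀ r, r ≠ 0 → N - 1 - r ≠ 0 → f r = a) :
    ∑ r ∈ Finset.range N, f r = f 0 + f (N - 1) + (N - 2) * a := by
  obtain ⟨M, rfl⟩ := Nat.exists_eq_add_of_le hN
  rw [add_comm 2 M, Finset.sum_range_succ, sum_range_eq_of_pos M.succ_pos fun r hr hrM =>
    h r hr (by omega), Nat.add_sub_cancel]
  exact add_right_comm _ _ _

/-- The class, up to `k`-binomial equivalence, of the factor of length `n` of `x` at position
`q`. -/
def blockClass (k : ℕ) (x : ℕ → Fin 2) (n q : ℕ) : Quotient (binomSetoid (Fin 2) k) :=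
  Quotient.mk _ (block x q n)

theorem blockClass_eq_iff {k n q q' : ℕ} {x : ℕ → Fin 2} :
    blockClass k x n q = blockClass k x n q' ↔ BinomEquiv k (block x q n) (block x q' n) :=
  Quotient.eq

theorem binomComplexity_eq (k : ℕ) (x : ℕ → Fin 2) (n : ℕ) :
    binomComplexity k x n = (Set.range (blockClass k x n)).ncard := by
  rw [binomComplexity, factors, ← Set.range_comp]
  rfl

theorem finite_range_of_eq_block {α : Type*} {x : ℕ → Fin 2} {n : ℕ} {f : ℕ → α}
    (F : List (Fin 2) → α) (hf : ∀ q, f q = F (block x q n)) : (Set.range f).Finite :=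
  (Set.finite_range fun u : Fin n → Fin 2 => F (List.ofFn u)).subset
    (Set.range_subset_iff.2 fun q => ⟨_, (hf q).symm⟩)

theorem finite_range_blockClass (k : ℕ) (x : ℕ → Fin 2) (n : ℕ) :
    (Set.range (blockClass k x n)).Finite :=
  finite_range_of_eq_block (Quotient.mk _) fun _ => rfl

theorem binomComplexity_eq_sum {k n N : ℕ} {x : ℕ → Fin 2} (hN : 0 < N)
    (h : ∀ {r r' g g' : ℕ}, r < N → r' < N →
      BinomEquiv k (block x (N * g + r) n) (block x (N * g' + r') n) → r = r') :
    binomComplexity k x n =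
      ∑ r ∈ Finset.range N, (Set.range fun g => blockClass k x n (N * g + r)).ncard := by
  rw [binomComplexity_eq, ncard_range_eq_sum_mod hN (finite_range_blockClass k x n)]
  intro q q' hq
  rw [blockClass_eq_iff, ← Nat.div_add_mod q N, ← Nat.div_add_mod q' N] at hq
  exact h (Nat.mod_lt _ hN) (Nat.mod_lt _ hN) hq

end Counting

section Complexity

/-- The first letter, the weight and the last letter of the factor of length `m + 1` of `y` at
position `h`. -/
def endsWeight (y : ℕ → Fin 2) (m h : ℕ) : Fin 2 × ℕ × Fin 2 :=
  (y h, weight y h (m + 1), y (h + m))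

variable {k n m r s h h' M : ℕ} {y : ℕ → Fin 2}

theorem sameCover_zero_zero_iff :
    SameCover m 0 0 y h h' ↔ weight y h (m + 1) = weight y h' (m + 1) :=
  ⟨SameCover.weight_eq, fun hw => ⟨hw, absurd rfl, absurd rfl⟩⟩

theorem sameCover_iff_endsWeight_eq (hr : r ≠ 0) (hs : s ≠ 0) :
    SameCover m r s y h h' ↔ endsWeight y m h = endsWeight y m h' := by
  simp only [endsWeight, Prod.mk.injEq]
  exact ⟨fun hc => ⟨hc.left_eq hr, hc.weight_eq, hc.right_eq hs⟩,
    fun ⟨hl, hw, hr⟩ => ⟨hw, fun _ => hl, fun _ => hr⟩⟩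

theorem sameCover_zero_left_iff (hs : s ≠ 0) :
    SameCover m 0 s y h h' ↔ (endsWeight y m h).2 = (endsWeight y m h').2 := by
  simp only [endsWeight, Prod.mk.injEq]
  exact ⟨fun hc => ⟨hc.weight_eq, hc.right_eq hs⟩, fun ⟨hw, hr⟩ => ⟨hw, absurd rfl, fun _ => hr⟩⟩

theorem sameCover_zero_right_iff (hr : r ≠ 0) :
    SameCover m r 0 y h h' ↔ ((endsWeight y m h).1, (endsWeight y m h).2.1) =
      ((endsWeight y m h').1, (endsWeight y m h').2.1) := by
  simp only [endsWeight, Prod.mk.injEq]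
  exact ⟨fun hc => ⟨hc.left_eq hr, hc.weight_eq⟩, fun ⟨hl, hw⟩ => ⟨hw, fun _ => hl, absurd rfl⟩⟩

theorem binomComplexity_eq_sum_of_cubeFree (hy : CubeFree y) (hn : 2 * 2 ^ k ≤ n) :
    binomComplexity (k + 1) (tmInf^[k] y) n = ∑ r ∈ Finset.range (2 ^ k),
      (Set.range fun g => blockClass (k + 1) (tmInf^[k] y) n (2 ^ k * g + r)).ncard := by
  have hN := Nat.two_pow_pos k
  refine binomComplexity_eq_sum hN fun hr hr' hb => ?_
  obtain ⟨m, s, hc⟩ := IsCover.exists_of_lt (by omega : 0 < n) hr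
  obtain ⟨m', s', hc'⟩ := IsCover.exists_of_lt (by omega : 0 < n) hr'
  exact (sameCover_of_binomEquiv k hy hn hc hc' hb).1

theorem ncard_range_blockClass_eq {α : Type*} {F : ℕ → α} (hy : CubeFree y) (hn : 2 * 2 ^ k ≤ n)
    (hc : IsCover (2 ^ k) n m r s) (hF : ∀ {h h'}, SameCover m r s y h h' ↔ F h = F h') :
    (Set.range fun g => blockClass (k + 1) (tmInf^[k] y) n (2 ^ k * g + r)).ncard =
      (Set.range F).ncard :=
  ncard_range_congr fun h h' => by
    rw [blockClass_eq_iff, binomEquiv_iff_sameCover hy hn hc hc, hF, eq_self, true_and]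

theorem isCover_mul {N m : ℕ} (hN : 0 < N) : IsCover N (N * (m + 1)) m 0 0 :=
  ⟨hN, hN, by ring⟩

theorem isCover_mul_of_pos {N m r : ℕ} (hr : r ≠ 0) (hrN : r < N) :
    IsCover N (N * m) m r (N - r) :=
  ⟨hrN, by omega, by rw [mul_add]; omega⟩

theorem isCover_mul_add_one {N m r : ℕ} (hr : r < N) :
    IsCover N (N * m + 1) m r (N - 1 - r) :=
  ⟨hr, by omega, by rw [mul_add]; omega⟩

theorem binomComplexity_mul (hy : CubeFree y) (hM : 2 ≤ M) :
    binomComplexity (k + 1) (tmInf^[k] y) (2 ^ k * M) =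
      (Set.range fun h => weight y h M).ncard +
        (2 ^ k - 1) * (Set.range (endsWeight y M)).ncard := by
  have hN := Nat.two_pow_pos k
  have hn : 2 * 2 ^ k ≤ 2 ^ k * M := by
    rw [mul_comm]
    exact Nat.mul_le_mul_left _ hM
  obtain ⟨m, rfl⟩ := Nat.exists_eq_add_of_lt (by omega : 0 < M)
  rw [binomComplexity_eq_sum_of_cubeFree hy hn, sum_range_eq_of_pos hN fun r hr hrN =>
      ncard_range_blockClass_eq hy hn (isCover_mul_of_pos hr hrN)
        (sameCover_iff_endsWeight_eq hr (by omega)),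
    ncard_range_blockClass_eq (F := fun h => weight y h (0 + m + 1)) hy hn (isCover_mul hN)
      sameCover_zero_zero_iff]

theorem binomComplexity_mul_add_one (hy : CubeFree y) (hM : 2 ≤ M) :
    binomComplexity (k + 2) (tmInf^[k + 1] y) (2 ^ (k + 1) * M + 1) =
      (Set.range fun h => (endsWeight y M h).2).ncard +
        (Set.range fun h => ((endsWeight y M h).1, (endsWeight y M h).2.1)).ncard +
          (2 ^ (k + 1) - 2) * (Set.range (endsWeight y M)).ncard := by
  have hN : 2 ≤ 2 ^ (k + 1) := Nat.le_self_pow k.succ_ne_zero 2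
  have hn : 2 * 2 ^ (k + 1) ≤ 2 ^ (k + 1) * M + 1 := by
    have := Nat.mul_le_mul_left (2 ^ (k + 1)) hM
    omega
  have hlast : IsCover (2 ^ (k + 1)) (2 ^ (k + 1) * M + 1) M (2 ^ (k + 1) - 1) 0 := by
    simpa using isCover_mul_add_one (N := 2 ^ (k + 1)) (m := M) (r := 2 ^ (k + 1) - 1) (by omega)
  rw [binomComplexity_eq_sum_of_cubeFree hy hn, sum_range_eq_of_pos_of_lt hN fun r hr hs =>
      ncard_range_blockClass_eq hy hn (isCover_mul_add_one (by omega))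
        (sameCover_iff_endsWeight_eq hr hs),
    ncard_range_blockClass_eq hy hn (isCover_mul_add_one (by omega))
      (sameCover_zero_left_iff (by omega)),
    ncard_range_blockClass_eq hy hn hlast (sameCover_zero_right_iff (by omega))]

theorem binomComplexity_four_mul (k : ℕ) (y : ℕ → Fin 2) :
    binomComplexity (k + 2) (tmInf^[k + 1] y) (2 ^ k * 4) =
      (Set.range fun h => (weight (tmInf y) h 4, posSum (tmInf y) h 4)).ncard + (2 ^ k - 1) *
        (Set.range fun h => (endsWeight (tmInf y) 4 h, posSum (tmInf y) h 5)).ncard := by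
  have hN := Nat.two_pow_pos k
  have hn : 4 * 2 ^ k ≤ 2 ^ k * 4 := (mul_comm _ _).le
  rw [Function.iterate_succ_apply, binomComplexity_eq_sum hN fun hr hr' hb => ?_,
    sum_range_eq_of_pos hN fun r hr hrN => ncard_range_congr
      (g := fun h => (endsWeight (tmInf y) 4 h, posSum (tmInf y) h 5)) fun h h' => ?_]
  · congr 1
    refine ncard_range_congr fun h h' => ?_
    rw [blockClass_eq_iff, binomEquiv_tmInf_iff hn (isCover_mul hN) (isCover_mul hN),
      sameCover_zero_zero_iff, eq_self, true_and, Prod.mk.injEq]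
  · rw [blockClass_eq_iff, binomEquiv_tmInf_iff hn (isCover_mul_of_pos hr hrN)
      (isCover_mul_of_pos hr hrN), sameCover_iff_endsWeight_eq hr (by omega), eq_self, true_and,
      ← Prod.mk.injEq]
  · obtain ⟨m, s, hc⟩ := IsCover.exists_of_lt (by omega : 0 < 2 ^ k * 4) hr
    obtain ⟨m', s', hc'⟩ := IsCover.exists_of_lt (by omega : 0 < 2 ^ k * 4) hr'
    exact ((binomEquiv_tmInf_iff hn hc hc').1 hb).1

theorem binomComplexity_two_five (y : ℕ → Fin 2) :
    binomComplexity 2 (tmInf y) 5 =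
      (Set.range fun h => (weight (tmInf y) h 5, posSum (tmInf y) h 5)).ncard := by
  have hc : IsCover (2 ^ 0) 5 4 0 0 := ⟨one_pos, one_pos, rfl⟩
  rw [binomComplexity_eq]
  refine ncard_range_congr fun h h' => ?_
  have hiff := binomEquiv_tmInf_iff (y := y) (h := h) (h' := h') (by norm_num) hc hc
  simpa [blockClass_eq_iff, sameCover_zero_zero_iff] using hiff

theorem binomComplexity_one (y : ℕ → Fin 2) (n : ℕ) :
    binomComplexity 1 y n = (Set.range fun h => weight y h n).ncard := by
  rw [binomComplexity_eq]
  refine ncard_range_congr fun h h' => ?_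
  rw [blockClass_eq_iff]
  exact ⟨BinomEquiv.count_one_eq, binomEquiv_tm_iterate_of_count_eq 0
    (by rw [length_block, length_block])⟩

end Complexity

section ShortFactors

theorem take_block {α : Type*} (x : ℕ → α) (q m n : ℕ) :
    (block x q (m + n)).take m = block x q m := by
  rw [block_add, List.take_left' (length_block x q m)]

theorem drop_block {α : Type*} (x : ℕ → α) (q m n : ℕ) :
    (block x q (m + n)).drop m = block x (q + m) n := by
  rw [block_add, List.drop_left' (length_block x q m)]

/-- The factors of length three of `y`, as triples of letters. -/
noncomputable def threeFactors (y : ℕ → Fin 2) : Finset (Fin 2 × Fin 2 × Fin 2) :=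
  (Set.toFinite (Set.range fun h => (y h, y (h + 1), y (h + 2)))).toFinset

theorem mem_threeFactors {y : ℕ → Fin 2} {τ : Fin 2 × Fin 2 × Fin 2} :
    τ ∈ threeFactors y ↔ ∃ h, (y h, y (h + 1), y (h + 2)) = τ := by
  simp [threeFactors]

/-- The values of `F` at the words of length five that occur in the images under the Thue–Morse
morphism of the words `abc` with `(a, b, c) ∈ Y`. -/
def imageFive {α : Type*} [DecidableEq α] (F : List (Fin 2) → α)
    (Y : Finset (Fin 2 × Fin 2 × Fin 2)) : Finset α :=
  Y.image (fun τ => F ((tm [τ.1, τ.2.1, τ.2.2]).take 5)) ∪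
    Y.image (fun τ => F ((tm [τ.1, τ.2.1, τ.2.2]).drop 1))

theorem ncard_range_eq_card_imageFive {α : Type*} [DecidableEq α] {F : List (Fin 2) → α}
    {f : ℕ → α} (y : ℕ → Fin 2) (hf : ∀ h, f h = F (block (tmInf y) h 5)) :
    (Set.range f).ncard = (imageFive F (threeFactors y)).card := by
  have hblock : ∀ g, tm [y g, y (g + 1), y (g + 2)] = block (tmInf y) (2 * g) (1 + 5) :=
    fun g => (block_tmInf_iterate y 1 g 3).symm
  have heven : ∀ g, f (2 * g) = F ((tm [y g, y (g + 1), y (g + 2)]).take 5) := fun g => by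
    rw [hf, hblock, take_block _ _ 5 1]
  have hodd : ∀ g, f (2 * g + 1) = F ((tm [y g, y (g + 1), y (g + 2)]).drop 1) := fun g => by
    rw [hf, hblock, drop_block]
  rw [← Set.ncard_coe_finset]
  congr 1
  ext a
  simp only [Set.mem_range, imageFive, Finset.coe_union, Finset.coe_image, Set.mem_union,
    Set.mem_image, Finset.mem_coe, mem_threeFactors]
  constructor
  · rintro ⟨h, rfl⟩
    obtain ⟨g, rfl | rfl⟩ := Nat.even_or_odd' h
    · exact Or.inl ⟨_, ⟨g, rfl⟩, (heven g).symm⟩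
    · exact Or.inr ⟨_, ⟨g, rfl⟩, (hodd g).symm⟩
  · rintro (⟨_, ⟨g, rfl⟩, rfl⟩ | ⟨_, ⟨g, rfl⟩, rfl⟩)
    · exact ⟨_, heven g⟩
    · exact ⟨_, hodd g⟩

/-- The number of letters `1` in `w` and the sum of their positions. -/
def weightPos (w : List (Fin 2)) : ℕ × ℕ :=
  (w.count 1, onesPos w)

/-- The first letter, the weight, the last letter and the sum of the positions of the letters `1`
of a word of length five. -/
def endsWeightPos (w : List (Fin 2)) : (Fin 2 × ℕ × Fin 2) × ℕ :=
  ((w.getD 0 0, w.count 1, w.getD 4 0), onesPos w)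

theorem binomComplexity_four_mul_eq_card (k : ℕ) (y : ℕ → Fin 2) :
    binomComplexity (k + 2) (tmInf^[k + 1] y) (2 ^ k * 4) =
      (imageFive (fun w => weightPos (w.take 4)) (threeFactors y)).card +
        (2 ^ k - 1) * (imageFive endsWeightPos (threeFactors y)).card := by
  rw [binomComplexity_four_mul, ← ncard_range_eq_card_imageFive y fun _ => rfl,
    ← ncard_range_eq_card_imageFive y fun _ => rfl]
  simp only [weightPos, take_block _ _ 4 1]
  rfl

theorem binomComplexity_two_five_eq_card (y : ℕ → Fin 2) :
    binomComplexity 2 (tmInf y) 5 = (imageFive weightPos (threeFactors y)).card := by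
  rw [binomComplexity_two_five, ← ncard_range_eq_card_imageFive y fun _ => rfl]
  rfl

set_option maxRecDepth 10000 in
theorem card_imageFive_of_cube_mem : ∀ Y : Finset (Fin 2 × Fin 2 × Fin 2), (∃ a, (a, a, a) ∈ Y) →
    ((imageFive (fun w => weightPos (w.take 4)) Y).card = 9 ∧
      12 < (imageFive endsWeightPos Y).card ∧ (imageFive weightPos Y).card ≠ 8) ∨
    ((imageFive (fun w => weightPos (w.take 4)) Y).card < 9 ∧
      (imageFive endsWeightPos Y).card ≤ 12) := by
  decide +kernel

/-- The words of length three that are not cubes of a letter. -/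
def nonCubes : Finset (Fin 2 × Fin 2 × Fin 2) :=
  {(0, 0, 1), (0, 1, 0), (0, 1, 1), (1, 0, 0), (1, 0, 1), (1, 1, 0)}

theorem mem_nonCubes_iff : ∀ {a b c : Fin 2}, (a, b, c) ∈ nonCubes ↔ (a = b → b ≠ c) := by
  decide

theorem card_imageFive_nonCubes :
    (imageFive (fun w => weightPos (w.take 4)) nonCubes).card = 9 ∧
      (imageFive endsWeightPos nonCubes).card = 12 ∧ (imageFive weightPos nonCubes).card = 8 := by
  decide +kernel

theorem cubeFree_of_binomComplexity_eq {k : ℕ} {y t : ℕ → Fin 2} (ht : threeFactors t = nonCubes)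
    (h : binomComplexity (k + 2) (tmInf^[k + 1] y) = binomComplexity (k + 2) (tmInf^[k + 1] t)) :
    CubeFree y := by
  intro i h₁ h₂
  have hcube : ∃ a, (a, a, a) ∈ threeFactors y :=
    ⟨y i, mem_threeFactors.2 ⟨i, by rw [← h₂, ← h₁]⟩⟩
  obtain ⟨hfour, hends, hfive⟩ := card_imageFive_nonCubes
  have hlong := congrFun h (2 ^ k * 4)
  rw [binomComplexity_four_mul_eq_card, binomComplexity_four_mul_eq_card, ht, hfour, hends]
    at hlong
  rcases card_imageFive_of_cube_mem _ hcube with ⟨hfour', hends', hfive'⟩ | ⟨hfour', hends'⟩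
  · obtain rfl | hk := Nat.eq_zero_or_pos k
    · have hshort := congrFun h 5
      rw [zero_add, Function.iterate_one, binomComplexity_two_five_eq_card,
        binomComplexity_two_five_eq_card, ht, hfive] at hshort
      exact hfive' hshort
    · have hk_pow := Nat.one_lt_two_pow hk.ne'
      have := Nat.mul_lt_mul_of_pos_left hends' (by omega : 0 < 2 ^ k - 1)
      omega
  · have := Nat.mul_le_mul_left (2 ^ k - 1) hends'
    omega

end ShortFactors

section EndsWeight

variable (y : ℕ → Fin 2) (p h : ℕ)

theorem endsWeight_tmInf_even_even :
    endsWeight (tmInf y) (2 * p) (2 * h) = (y h, p + (y (h + p)).val, y (h + p)) := by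
  have hweight := weight_tmInf_window (y := y) (g := h) (e := 0) (L := 2 * p + 1) (d := 1) (m := p)
    zero_le_one le_rfl (by ring)
  have hval := val_one_sub (y (h + p))
  rw [endsWeight, ← mul_add, tmInf_even, tmInf_even, Prod.mk.injEq, Prod.mk.injEq]
  exact ⟨rfl, by rw [add_zero] at hweight; omega, rfl⟩

theorem endsWeight_tmInf_even_odd :
    endsWeight (tmInf y) (2 * p) (2 * h + 1) =
      (1 - y h, p + (1 - y h).val, 1 - y (h + p)) := by
  have hweight := weight_tmInf_window (y := y) (g := h) (e := 1) (L := 2 * p + 1) (d := 0) (m := p)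
    le_rfl zero_le_one (by ring)
  have hval := val_one_sub (y h)
  rw [endsWeight, add_right_comm, ← mul_add, tmInf_odd, tmInf_odd, Prod.mk.injEq, Prod.mk.injEq]
  exact ⟨rfl, by omega, rfl⟩

theorem endsWeight_tmInf_odd_even :
    endsWeight (tmInf y) (2 * p + 1) (2 * h) = (y h, p + 1, 1 - y (h + p)) := by
  rw [endsWeight, ← add_assoc, ← mul_add, tmInf_even, tmInf_odd]
  exact congrArg (fun w => (y h, w, 1 - y (h + p))) (weight_tmInf_two_mul y h (p + 1))

theorem endsWeight_tmInf_odd_odd :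
    endsWeight (tmInf y) (2 * p + 1) (2 * h + 1) =
      (1 - y h, p + (1 - y h).val + (y (h + (p + 1))).val, y (h + (p + 1))) := by
  have hweight := weight_tmInf_window (y := y) (g := h) (e := 1) (L := 2 * p + 1 + 1) (d := 1)
    (m := p + 1) le_rfl le_rfl (by ring)
  have hval := val_one_sub (y h)
  have hval' := val_one_sub (y (h + (p + 1)))
  have hlast : 2 * h + 1 + (2 * p + 1) = 2 * (h + (p + 1)) := by ring
  rw [endsWeight, hlast, tmInf_odd, tmInf_even, Prod.mk.injEq, Prod.mk.injEq]
  exact ⟨rfl, by omega, rfl⟩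

variable {y p}

theorem range_endsWeight_tmInf_even (hy : ∀ a b, ∃ i, y i = a ∧ y (i + p) = b) :
    Set.range (endsWeight (tmInf y) (2 * p)) =
      {τ | τ.2.1 = p + τ.2.2.val ∨ τ.2.1 = p + τ.1.val} := by
  ext ⟨a, w, b⟩
  constructor
  · rintro ⟨q, hq⟩
    rw [← hq]
    obtain ⟨h, rfl | rfl⟩ := Nat.even_or_odd' q
    · exact Or.inl (by rw [endsWeight_tmInf_even_even])
    · exact Or.inr (by rw [endsWeight_tmInf_even_odd])
  · rintro (hw | hw)
    · obtain rfl : w = p + b.val := hw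
      obtain ⟨i, rfl, rfl⟩ := hy a b
      exact ⟨2 * i, endsWeight_tmInf_even_even y p i⟩
    · obtain rfl : w = p + a.val := hw
      obtain ⟨i, ha, hb⟩ := hy (1 - a) (1 - b)
      exact ⟨2 * i + 1, by rw [endsWeight_tmInf_even_odd, ha, hb, sub_sub_cancel, sub_sub_cancel]⟩

theorem range_endsWeight_tmInf_odd (hy : ∀ a b, ∃ i, y i = a ∧ y (i + p) = b)
    (hy' : ∀ a b, ∃ i, y i = a ∧ y (i + (p + 1)) = b) :
    Set.range (endsWeight (tmInf y) (2 * p + 1)) =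
      {τ | τ.2.1 = p + 1 ∨ τ.2.1 = p + τ.1.val + τ.2.2.val} := by
  ext ⟨a, w, b⟩
  constructor
  · rintro ⟨q, hq⟩
    rw [← hq]
    obtain ⟨h, rfl | rfl⟩ := Nat.even_or_odd' q
    · exact Or.inl (by rw [endsWeight_tmInf_odd_even])
    · exact Or.inr (by rw [endsWeight_tmInf_odd_odd])
  · rintro (hw | hw)
    · obtain rfl : w = p + 1 := hw
      obtain ⟨i, rfl, hb⟩ := hy a (1 - b)
      exact ⟨2 * i, by rw [endsWeight_tmInf_odd_even, hb, sub_sub_cancel]⟩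
    · obtain rfl : w = p + a.val + b.val := hw
      obtain ⟨i, ha, rfl⟩ := hy' (1 - a) b
      exact ⟨2 * i + 1, by rw [endsWeight_tmInf_odd_odd, ha, sub_sub_cancel]⟩

end EndsWeight

section ThueMorse

theorem tmInf_thueMorse : tmInf thueMorse = thueMorse := thueMorse_fixed.2

theorem tmInf_iterate_thueMorse (k : ℕ) : tmInf^[k] thueMorse = thueMorse :=
  Function.iterate_fixed tmInf_thueMorse k

theorem thueMorse_even (h : ℕ) : thueMorse (2 * h) = thueMorse h := by
  conv_lhs => rw [← tmInf_thueMorse, tmInf_even]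

theorem thueMorse_odd (h : ℕ) : thueMorse (2 * h + 1) = 1 - thueMorse h := by
  conv_lhs => rw [← tmInf_thueMorse, tmInf_odd]

theorem cubeFree_thueMorse : CubeFree thueMorse := by
  rw [← tmInf_thueMorse]
  exact cubeFree_tmInf _

theorem threeFactors_thueMorse : threeFactors thueMorse = nonCubes := by
  ext τ
  rw [mem_threeFactors]
  constructor
  · rintro ⟨i, rfl⟩
    exact mem_nonCubes_iff.2 (cubeFree_thueMorse i)
  · have hoccur : ∀ τ ∈ nonCubes,
        ∃ i < 6, (thueMorse i, thueMorse (i + 1), thueMorse (i + 2)) = τ := by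
      decide
    exact fun h => (hoccur τ h).imp fun _ => And.right

theorem exists_thueMorse_eq_and_add_eq {d : ℕ} (hd : 0 < d) (a b : Fin 2) :
    ∃ i, thueMorse i = a ∧ thueMorse (i + d) = b := by
  induction d using Nat.strong_induction_on generalizing a b with
  | _ d ih =>
    obtain ⟨m, rfl | rfl⟩ := Nat.even_or_odd' d
    · obtain ⟨i, rfl, rfl⟩ := ih m (by omega) (by omega) a b
      exact ⟨2 * i, thueMorse_even i, by rw [← mul_add, thueMorse_even]⟩
    · rcases Nat.eq_zero_or_pos m with rfl | hm
      · have hpair : ∀ a b, ∃ i < 6, thueMorse i = a ∧ thueMorse (i + 1) = b := by decide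
        exact (hpair a b).imp fun _ => And.right
      · obtain ⟨i, rfl, hb⟩ := ih m (by omega) hm a (1 - b)
        exact ⟨2 * i, thueMorse_even i,
          by rw [← add_assoc, ← mul_add, thueMorse_odd, hb, sub_sub_cancel]⟩

theorem range_endsWeight_thueMorse_even {p : ℕ} (hp : 0 < p) :
    Set.range (endsWeight thueMorse (2 * p)) =
      {τ | τ.2.1 = p + τ.2.2.val ∨ τ.2.1 = p + τ.1.val} := by
  have hrange := range_endsWeight_tmInf_even (exists_thueMorse_eq_and_add_eq hp)
  rwa [tmInf_thueMorse] at hrange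

theorem range_endsWeight_thueMorse_odd {p : ℕ} (hp : 0 < p) :
    Set.range (endsWeight thueMorse (2 * p + 1)) =
      {τ | τ.2.1 = p + 1 ∨ τ.2.1 = p + τ.1.val + τ.2.2.val} := by
  have hrange := range_endsWeight_tmInf_odd (exists_thueMorse_eq_and_add_eq hp)
    (exists_thueMorse_eq_and_add_eq p.succ_pos)
  rwa [tmInf_thueMorse] at hrange

end ThueMorse

section EndsWeightRange

variable {y t : ℕ → Fin 2} {k m p : ℕ}

theorem finite_range_weight (y : ℕ → Fin 2) (m : ℕ) : (Set.range fun h => weight y h m).Finite :=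
  finite_range_of_eq_block (List.count 1) fun _ => rfl

theorem finite_range_endsWeight (y : ℕ → Fin 2) (m : ℕ) : (Set.range (endsWeight y m)).Finite :=
  (Set.finite_univ.prod ((finite_range_weight y (m + 1)).prod Set.finite_univ)).subset
    (Set.range_subset_iff.2 fun h => ⟨Set.mem_univ _, ⟨h, rfl⟩, Set.mem_univ _⟩)

theorem range_weight_succ (y : ℕ → Fin 2) (m : ℕ) :
    (Set.range fun h => weight y h (m + 1)) = (fun τ => τ.2.1) '' Set.range (endsWeight y m) :=
  Set.range_comp (fun τ : Fin 2 × ℕ × Fin 2 => τ.2.1) (endsWeight y m)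

theorem range_endsWeight_eq_of_subset (hk : 0 < k) (hm : 2 ≤ m) (hy : CubeFree y)
    (ht : CubeFree t)
    (h : binomComplexity (k + 1) (tmInf^[k] y) = binomComplexity (k + 1) (tmInf^[k] t))
    (hweight : (Set.range fun h => weight y h m) ⊆ Set.range fun h => weight t h m)
    (hends : Set.range (endsWeight y m) ⊆ Set.range (endsWeight t m)) :
    Set.range (endsWeight y m) = Set.range (endsWeight t m) := by
  have hcount := congrFun h (2 ^ k * m)
  rw [binomComplexity_mul hy hm, binomComplexity_mul ht hm] at hcount
  have hweight_le := Set.ncard_le_ncard hweight (finite_range_weight t m)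
  have hpow := Nat.one_lt_two_pow hk.ne'
  refine Set.eq_of_subset_of_ncard_le hends ?_ (finite_range_endsWeight t m)
  exact Nat.le_of_mul_le_mul_left (by omega) (show 0 < 2 ^ k - 1 by omega)

/-- The first letter, the weight and the last letter of a word `awb` in which `w` has weight
`p + e`, as a function of `(a, e, b)`. -/
def endsOfInterior (p : ℕ) (τ : Fin 2 × Fin 2 × Fin 2) : Fin 2 × ℕ × Fin 2 :=
  (τ.1, p + (τ.1.val + τ.2.1.val + τ.2.2.val), τ.2.2)

theorem endsOfInterior_injective (p : ℕ) : Function.Injective (endsOfInterior p) := by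
  rintro ⟨a, e, b⟩ ⟨a', e', b'⟩ h
  simp only [endsOfInterior, Prod.mk.injEq] at h
  obtain ⟨rfl, hweight, rfl⟩ := h
  obtain rfl : e = e' := by omega
  rfl

theorem endsWeight_eq_endsOfInterior {h : ℕ} {e : Fin 2}
    (he : weight y (h + 1) m = p + e.val) :
    endsWeight y (m + 1) h = endsOfInterior p (y h, e, y (h + (m + 1))) := by
  have hweight : weight y h (m + 1 + 1) = p + ((y h).val + e.val + (y (h + (m + 1))).val) := by
    rw [weight_succ_right, weight_succ_left, he]
    ring
  rw [endsWeight, hweight, endsOfInterior]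

/-- The number of pairs (weight, last letter) plus the number of pairs (first letter, weight) of
the words described by the elements of `Z` as in `endsOfInterior`. -/
def endCount (Z : Finset (Fin 2 × Fin 2 × Fin 2)) : ℕ :=
  (Z.image fun τ => (endsOfInterior 0 τ).2).card +
    (Z.image fun τ => ((endsOfInterior 0 τ).1, (endsOfInterior 0 τ).2.1)).card

theorem card_image_snd_endsOfInterior (p : ℕ) (Z : Finset (Fin 2 × Fin 2 × Fin 2)) :
    (Z.image fun τ => (endsOfInterior p τ).2).card +
      (Z.image fun τ => ((endsOfInterior p τ).1, (endsOfInterior p τ).2.1)).card = endCount Z := by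
  have hsnd : Function.Injective fun σ : ℕ × Fin 2 => (p + σ.1, σ.2) := fun σ σ' h => by
    simpa [Prod.ext_iff] using h
  have hfst : Function.Injective fun σ : Fin 2 × ℕ => (σ.1, p + σ.2) := fun σ σ' h => by
    simpa [Prod.ext_iff] using h
  rw [endCount, ← Finset.card_image_of_injective (Z.image fun τ => (endsOfInterior 0 τ).2) hsnd,
    ← Finset.card_image_of_injective
      (Z.image fun τ => ((endsOfInterior 0 τ).1, (endsOfInterior 0 τ).2.1)) hfst,
    Finset.image_image, Finset.image_image]
  simp only [endsOfInterior, Function.comp_def, zero_add]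

variable {Z : Finset (Fin 2 × Fin 2 × Fin 2)}

theorem ncard_range_endsWeight (hZ : Set.range (endsWeight y m) = endsOfInterior p '' Z) :
    (Set.range (endsWeight y m)).ncard = Z.card := by
  rw [hZ, Set.ncard_image_of_injective _ (endsOfInterior_injective p), Set.ncard_coe_finset]

theorem ncard_range_comp_endsWeight {α : Type*} [DecidableEq α] (f : Fin 2 × ℕ × Fin 2 → α)
    (hZ : Set.range (endsWeight y m) = endsOfInterior p '' Z) :
    (Set.range fun h => f (endsWeight y m h)).ncard =
      (Z.image fun τ => f (endsOfInterior p τ)).card := by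
  rw [← Set.ncard_coe_finset, Finset.coe_image, ← Function.comp_def f, ← Function.comp_def f,
    Set.range_comp, hZ, Set.image_image, Function.comp_def]

theorem binomComplexity_mul_add_one_eq_endCount (hy : CubeFree y) (hm : 2 ≤ m)
    (hZ : Set.range (endsWeight y m) = endsOfInterior p '' Z) :
    binomComplexity (k + 2) (tmInf^[k + 1] y) (2 ^ (k + 1) * m + 1) =
      endCount Z + (2 ^ (k + 1) - 2) * Z.card := by
  rw [binomComplexity_mul_add_one hy hm, ncard_range_endsWeight hZ,
    ncard_range_comp_endsWeight Prod.snd hZ,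
    ncard_range_comp_endsWeight (fun τ => (τ.1, τ.2.1)) hZ, card_image_snd_endsOfInterior]

set_option maxRecDepth 10000 in
theorem eq_nonCubes_of_card_eq :
    ∀ Z : Finset (Fin 2 × Fin 2 × Fin 2), Z.card = nonCubes.card → endCount Z = endCount nonCubes →
      Z = nonCubes := by
  decide +kernel

theorem eq_image_nonCubes_of_binomComplexity_eq (hy : CubeFree y) (ht : CubeFree t) (hm : 2 ≤ m)
    (h : binomComplexity (k + 2) (tmInf^[k + 1] y) = binomComplexity (k + 2) (tmInf^[k + 1] t))
    (hweight : (Set.range fun h => weight y h m) = Set.range fun h => weight t h m)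
    (hends : Set.range (endsWeight y m) ⊆ Set.range (endsOfInterior p))
    (hends_t : Set.range (endsWeight t m) = endsOfInterior p '' nonCubes) :
    Set.range (endsWeight y m) = endsOfInterior p '' nonCubes := by
  obtain ⟨Z, hZ⟩ := Set.subset_range_iff_exists_image_eq.1 hends
  lift Z to Finset (Fin 2 × Fin 2 × Fin 2) using Set.toFinite Z
  have hpow : 2 ≤ 2 ^ (k + 1) := Nat.le_self_pow k.succ_ne_zero 2
  have hcard : Z.card = nonCubes.card := by
    have hcount := congrFun h (2 ^ (k + 1) * m)
    rw [binomComplexity_mul hy hm, binomComplexity_mul ht hm, hweight, Nat.add_left_cancel_iff,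
      ncard_range_endsWeight hZ.symm, ncard_range_endsWeight hends_t] at hcount
    exact Nat.eq_of_mul_eq_mul_left (by omega) hcount
  have hendCount : endCount Z = endCount nonCubes := by
    have hcount := congrFun h (2 ^ (k + 1) * m + 1)
    rw [binomComplexity_mul_add_one_eq_endCount hy hm hZ.symm,
      binomComplexity_mul_add_one_eq_endCount ht hm hends_t, hcard] at hcount
    exact Nat.add_right_cancel hcount
  rw [← hZ, eq_nonCubes_of_card_eq Z hcard hendCount]

end EndsWeightRange

section EndsWeightThueMorse

variable {y : ℕ → Fin 2} {k p : ℕ}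

theorem range_endsWeight_thueMorse_eq_image (p : ℕ) :
    Set.range (endsWeight thueMorse (2 * (p + 1))) = endsOfInterior p '' nonCubes := by
  rw [range_endsWeight_thueMorse_even p.succ_pos]
  ext ⟨a, w, b⟩
  constructor
  · rintro (hw | hw)
    · obtain rfl : w = p + 1 + b.val := hw
      have hweight : p + (a.val + (1 - a).val + b.val) = p + 1 + b.val := by
        have := val_one_sub a
        omega
      exact ⟨(a, 1 - a, b), mem_nonCubes_iff.2 (by omega), Prod.ext rfl (Prod.ext hweight rfl)⟩
    · obtain rfl : w = p + 1 + a.val := hw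
      have hweight : p + (a.val + (1 - b).val + b.val) = p + 1 + a.val := by
        have := val_one_sub b
        omega
      exact ⟨(a, 1 - b, b), mem_nonCubes_iff.2 (by omega), Prod.ext rfl (Prod.ext hweight rfl)⟩
  · rintro ⟨⟨a, e, b⟩, hmem, h⟩
    rw [← h]
    have hne := mem_nonCubes_iff.1 hmem
    change p + (a.val + e.val + b.val) = p + 1 + b.val ∨ p + (a.val + e.val + b.val) = p + 1 + a.val
    omega

theorem weight_of_range_endsWeight_eq (hp : 0 < p)
    (h : Set.range (endsWeight y (2 * p)) = Set.range (endsWeight thueMorse (2 * p))) (q : ℕ) :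
    weight y q (2 * p + 1) = p + (y (q + 2 * p)).val ∨ weight y q (2 * p + 1) = p + (y q).val := by
  rw [range_endsWeight_thueMorse_even hp] at h
  exact h.subset ⟨q, rfl⟩

theorem range_weight_succ_eq {m : ℕ}
    (h : Set.range (endsWeight y m) = Set.range (endsWeight thueMorse m)) :
    (Set.range fun h => weight y h (m + 1)) = Set.range fun h => weight thueMorse h (m + 1) := by
  rw [range_weight_succ, range_weight_succ, h]

theorem range_endsWeight_two_eq (hy : CubeFree y)
    (h : binomComplexity (k + 2) (tmInf^[k + 1] y) =
      binomComplexity (k + 2) (tmInf^[k + 1] thueMorse)) :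
    Set.range (endsWeight y 2) = Set.range (endsWeight thueMorse 2) := by
  refine range_endsWeight_eq_of_subset k.succ_pos le_rfl hy cubeFree_thueMorse h ?_ ?_
  · have hoccur : ∀ w ≤ 2, ∃ q < 6, weight thueMorse q 2 = w := by decide
    rintro _ ⟨q, rfl⟩
    exact (hoccur _ (weight_le y q 2)).imp fun _ => And.right
  · rw [range_endsWeight_thueMorse_eq_image 0]
    rintro _ ⟨q, rfl⟩
    have hinterior : weight y (q + 1) 1 = 0 + (y (q + 1)).val := by rw [weight_one, zero_add]
    rw [endsWeight_eq_endsOfInterior hinterior]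
    exact Set.mem_image_of_mem _ (mem_nonCubes_iff.2 (hy q))

theorem range_endsWeight_succ_eq (hp : 0 < p) (hy : CubeFree y)
    (h : binomComplexity (k + 2) (tmInf^[k + 1] y) =
      binomComplexity (k + 2) (tmInf^[k + 1] thueMorse))
    (hends : Set.range (endsWeight y (2 * p)) = Set.range (endsWeight thueMorse (2 * p))) :
    Set.range (endsWeight y (2 * p + 1)) = Set.range (endsWeight thueMorse (2 * p + 1)) := by
  refine range_endsWeight_eq_of_subset k.succ_pos (by omega) hy cubeFree_thueMorse h
    (range_weight_succ_eq hends).subset ?_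
  rw [range_endsWeight_thueMorse_odd hp]
  rintro _ ⟨q, rfl⟩
  have hprefix := weight_of_range_endsWeight_eq hp hends q
  have hsuffix := weight_of_range_endsWeight_eq hp hends (q + 1)
  have hleft := weight_succ_left y q (2 * p + 1)
  have hright := weight_succ_right y q (2 * p + 1)
  rw [show q + 1 + 2 * p = q + (2 * p + 1) by ring] at hsuffix
  change weight y q (2 * p + 1 + 1) = p + 1 ∨
    weight y q (2 * p + 1 + 1) = p + (y q).val + (y (q + (2 * p + 1))).val
  omega

theorem range_endsWeight_two_mul_succ_eq (hp : 0 < p) (hy : CubeFree y)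
    (h : binomComplexity (k + 2) (tmInf^[k + 1] y) =
      binomComplexity (k + 2) (tmInf^[k + 1] thueMorse))
    (hends : Set.range (endsWeight y (2 * p)) = Set.range (endsWeight thueMorse (2 * p))) :
    Set.range (endsWeight y (2 * (p + 1))) = Set.range (endsWeight thueMorse (2 * (p + 1))) := by
  rw [range_endsWeight_thueMorse_eq_image]
  refine eq_image_nonCubes_of_binomComplexity_eq hy cubeFree_thueMorse (by omega) h
    (range_weight_succ_eq (range_endsWeight_succ_eq hp hy h hends)) ?_
    (range_endsWeight_thueMorse_eq_image p)
  rintro _ ⟨q, rfl⟩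
  rcases weight_of_range_endsWeight_eq hp hends (q + 1) with hweight | hweight
  · exact ⟨_, (endsWeight_eq_endsOfInterior hweight).symm⟩
  · exact ⟨_, (endsWeight_eq_endsOfInterior hweight).symm⟩

theorem range_endsWeight_eq (hy : CubeFree y)
    (h : binomComplexity (k + 2) (tmInf^[k + 1] y) =
      binomComplexity (k + 2) (tmInf^[k + 1] thueMorse)) (p : ℕ) :
    Set.range (endsWeight y (2 * (p + 1))) = Set.range (endsWeight thueMorse (2 * (p + 1))) := by
  induction p with
  | zero => exact range_endsWeight_two_eq hy h
  | succ p ih => exact range_endsWeight_two_mul_succ_eq p.succ_pos hy h ih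

end EndsWeightThueMorse

section OddBalanced

variable {y : ℕ → Fin 2}

/-- In every factor of odd length of `y`, the numbers of letters `0` and `1` differ by one. -/
def OddBalanced (y : ℕ → Fin 2) : Prop :=
  ∀ p h, p ≤ weight y h (2 * p + 1) ∧ weight y h (2 * p + 1) ≤ p + 1

theorem oddBalanced_of_succ
    (h : ∀ p h, p + 1 ≤ weight y h (2 * (p + 1) + 1) ∧ weight y h (2 * (p + 1) + 1) ≤ p + 2) :
    OddBalanced y := by
  rintro (_ | p) q
  · exact ⟨Nat.zero_le _, weight_le y q 1⟩
  · exact h p q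

theorem oddBalanced_tmInf (y : ℕ → Fin 2) : OddBalanced (tmInf y) := by
  intro p q
  obtain ⟨h, rfl | rfl⟩ := Nat.even_or_odd' q
  · have hweight := congrArg (fun τ => τ.2.1) (endsWeight_tmInf_even_even y p h)
    change weight (tmInf y) (2 * h) (2 * p + 1) = p + (y (h + p)).val at hweight
    omega
  · have hweight := congrArg (fun τ => τ.2.1) (endsWeight_tmInf_even_odd y p h)
    change weight (tmInf y) (2 * h + 1) (2 * p + 1) = p + (1 - y h).val at hweight
    omega

theorem oddBalanced_thueMorse : OddBalanced thueMorse :=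
  tmInf_thueMorse ▸ oddBalanced_tmInf thueMorse

theorem oddBalanced_of_range_endsWeight_eq
    (h : ∀ p, Set.range (endsWeight y (2 * (p + 1))) =
      Set.range (endsWeight thueMorse (2 * (p + 1)))) :
    OddBalanced y := by
  refine oddBalanced_of_succ fun p q => ?_
  have := weight_of_range_endsWeight_eq (Nat.succ_pos p) (h p) q
  rw [Nat.succ_eq_add_one] at this
  omega

theorem exists_eq_succ_of_range_endsWeight_eq
    (h : Set.range (endsWeight y 2) = Set.range (endsWeight thueMorse 2)) :
    ∃ i, y i = y (i + 1) := by
  have hmem : ((0 : Fin 2), 2, (1 : Fin 2)) ∈ Set.range (endsWeight thueMorse (2 * 1)) := by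
    rw [range_endsWeight_thueMorse_even one_pos]
    exact Or.inl rfl
  obtain ⟨i, hi⟩ := h.symm.subset hmem
  simp only [endsWeight, weight_succ_left, weight_zero, Prod.mk.injEq] at hi
  obtain ⟨hfirst, hweight, hlast⟩ := hi
  rw [hfirst, add_assoc i, hlast] at hweight
  exact ⟨i + 1, by rw [add_assoc i, hlast]; omega⟩

end OddBalanced

section Abelian

variable {y : ℕ → Fin 2} {p : ℕ}

theorem exists_eq_of_le_of_le {f : ℕ → ℕ} (hf : ∀ i, f (i + 1) ≤ f i + 1 ∧ f i ≤ f (i + 1) + 1)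
    {a b c : ℕ} (ha : f a ≤ c) (hb : c ≤ f b) : ∃ i, f i = c := by
  by_contra! hne
  have hlt : ∀ i, f i < c ↔ f 0 < c := by
    intro i
    induction i with
    | zero => rfl
    | succ i ih =>
      rw [← ih]
      have := hf i
      have := hne i
      have := hne (i + 1)
      omega
  exact ((hlt b).2 ((hlt a).1 (ha.lt_of_ne (hne a)))).not_ge hb

theorem weight_succ_start (y : ℕ → Fin 2) (n h : ℕ) :
    weight y (h + 1) n ≤ weight y h n + 1 ∧ weight y h n ≤ weight y (h + 1) n + 1 := by
  have hleft := weight_succ_left y h n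
  have hright := weight_succ_right y h n
  omega

theorem Icc_subset_range_weight_thueMorse (p : ℕ) :
    Set.Icc p (p + 2) ⊆ Set.range fun h => weight thueMorse h (2 * (p + 1)) := by
  have hoccur : ∀ a b : Fin 2, ∃ q, weight thueMorse q (2 * (p + 1)) = p + a.val + b.val := by
    intro a b
    obtain ⟨i, ha, hb⟩ := exists_thueMorse_eq_and_add_eq p.succ_pos (1 - a) b
    have hends := endsWeight_tmInf_odd_odd thueMorse p i
    rw [tmInf_thueMorse, ha, hb, sub_sub_cancel] at hends
    exact ⟨2 * i + 1, congrArg (fun τ => τ.2.1) hends⟩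
  rintro w ⟨hpw, hwp⟩
  obtain rfl | rfl | rfl : w = p ∨ w = p + 1 ∨ w = p + 2 := by omega
  exacts [hoccur 0 0, hoccur 0 1, hoccur 1 1]

theorem ncard_range_weight_eq (h : binomComplexity 1 y = binomComplexity 1 thueMorse) (n : ℕ) :
    (Set.range fun q => weight y q n).ncard = (Set.range fun q => weight thueMorse q n).ncard := by
  rw [← binomComplexity_one, ← binomComplexity_one, h]

theorem range_weight_even_eq_Icc (h : binomComplexity 1 y = binomComplexity 1 thueMorse)
    (hsub : (Set.range fun q => weight y q (2 * (p + 1))) ⊆ Set.Icc p (p + 2)) :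
    (Set.range fun q => weight y q (2 * (p + 1))) = Set.Icc p (p + 2) := by
  refine Set.eq_of_subset_of_ncard_le hsub ?_ (Set.finite_Icc p (p + 2))
  rw [ncard_range_weight_eq h]
  exact Set.ncard_le_ncard (Icc_subset_range_weight_thueMorse p) (finite_range_weight _ _)

theorem range_weight_odd_eq_Icc (h : binomComplexity 1 y = binomComplexity 1 thueMorse)
    (heven : (Set.range fun q => weight y q (2 * (p + 1))) = Set.Icc p (p + 2)) :
    (Set.range fun q => weight y q (2 * (p + 1) + 1)) = Set.Icc (p + 1) (p + 2) := by
  obtain ⟨a, ha : weight y a _ = p⟩ :=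
    heven.symm.subset (Set.left_mem_Icc.2 (Nat.le_add_right p 2))
  obtain ⟨b, hb : weight y b _ = p + 2⟩ :=
    heven.symm.subset (Set.right_mem_Icc.2 (Nat.le_add_right p 2))
  have hlow : weight y a (2 * (p + 1) + 1) ≤ p + 1 := by
    rw [weight_succ_right, ha]
    omega
  have hhigh : p + 2 ≤ weight y b (2 * (p + 1) + 1) := by
    rw [weight_succ_right, hb]
    omega
  refine (Set.eq_of_subset_of_ncard_le (fun c hc => ?_) ?_ (finite_range_weight _ _)).symm
  · exact exists_eq_of_le_of_le (weight_succ_start y _) (hlow.trans hc.1) (hc.2.trans hhigh)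
  · rw [ncard_range_weight_eq h]
    exact Set.ncard_le_ncard (Set.range_subset_iff.2 (oddBalanced_thueMorse (p + 1)))
      (Set.finite_Icc _ _)

theorem range_weight_even_eq_Icc_of_binomComplexity_eq
    (h : binomComplexity 1 y = binomComplexity 1 thueMorse) (p : ℕ) :
    (Set.range fun q => weight y q (2 * (p + 1))) = Set.Icc p (p + 2) := by
  induction p with
  | zero =>
    exact range_weight_even_eq_Icc h
      (Set.range_subset_iff.2 fun q => ⟨Nat.zero_le _, weight_le y q 2⟩)
  | succ p ih =>
    refine range_weight_even_eq_Icc h (Set.range_subset_iff.2 fun q => ?_)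
    have hodd : p + 1 ≤ weight y q (2 * (p + 1) + 1) ∧ weight y q (2 * (p + 1) + 1) ≤ p + 2 :=
      (range_weight_odd_eq_Icc h ih).subset ⟨q, rfl⟩
    have hright := weight_succ_right y q (2 * (p + 1) + 1)
    change p + 1 ≤ weight y q (2 * (p + 1) + 1 + 1) ∧
      weight y q (2 * (p + 1) + 1 + 1) ≤ p + 1 + 2
    omega

theorem oddBalanced_of_binomComplexity_one_eq
    (h : binomComplexity 1 y = binomComplexity 1 thueMorse) : OddBalanced y :=
  oddBalanced_of_succ fun p q => (range_weight_odd_eq_Icc h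
    (range_weight_even_eq_Icc_of_binomComplexity_eq h p)).subset ⟨q, rfl⟩

theorem exists_eq_succ_of_binomComplexity_one_eq
    (h : binomComplexity 1 y = binomComplexity 1 thueMorse) : ∃ i, y i = y (i + 1) := by
  obtain ⟨i, hi⟩ := (range_weight_even_eq_Icc_of_binomComplexity_eq h 0).symm.subset
    (Set.left_mem_Icc.2 (Nat.zero_le 2))
  exact ⟨i, (eq_zero_of_weight_eq_zero hi two_pos).trans
    (eq_zero_of_weight_eq_zero hi one_lt_two).symm⟩

theorem oddBalanced_and_exists_eq_succ_of_binomComplexity_eq (k : ℕ)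
    (h : binomComplexity (k + 1) (tmInf^[k] y) = binomComplexity (k + 1) thueMorse) :
    OddBalanced y ∧ ∃ i, y i = y (i + 1) := by
  rcases k with _ | k
  · exact ⟨oddBalanced_of_binomComplexity_one_eq h, exists_eq_succ_of_binomComplexity_one_eq h⟩
  · rw [← tmInf_iterate_thueMorse (k + 1)] at h
    have hends := range_endsWeight_eq (cubeFree_of_binomComplexity_eq threeFactors_thueMorse h) h
    exact ⟨oddBalanced_of_range_endsWeight_eq hends,
      exists_eq_succ_of_range_endsWeight_eq (hends 0)⟩

end Abelian

section Desubstitution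

variable {y : ℕ → Fin 2}

theorem OddBalanced.weight_prefix (hy : OddBalanced y) (a b : ℕ) :
    weight y 0 (2 * a) + b ≤ weight y 0 (2 * b + 1) + a ∧
      weight y 0 (2 * b + 1) + a ≤ weight y 0 (2 * a) + b + 1 := by
  rcases le_or_gt a b with hab | hba
  · obtain ⟨d, rfl⟩ := Nat.exists_eq_add_of_le hab
    have hadd := weight_add y 0 (2 * a) (2 * d + 1)
    rw [show 2 * a + (2 * d + 1) = 2 * (a + d) + 1 by ring, zero_add] at hadd
    have := hy d (2 * a)
    omega
  · obtain ⟨d, rfl⟩ := Nat.exists_eq_add_of_lt hba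
    have hadd := weight_add y 0 (2 * b + 1) (2 * d + 1)
    rw [show 2 * b + 1 + (2 * d + 1) = 2 * (b + d + 1) by ring, zero_add] at hadd
    have := hy d (2 * b + 1)
    omega

theorem OddBalanced.weight_prefix_even_or_odd (hy : OddBalanced y) :
    (∀ a, weight y 0 (2 * a) = a) ∨ ∀ b, weight y 0 (2 * b + 1) = weight y 0 1 + b := by
  by_contra! ⟨⟨a, ha⟩, ⟨b, hb⟩⟩
  have h₁ := hy.weight_prefix 0 0
  have h₂ := hy.weight_prefix 0 b
  have h₃ := hy.weight_prefix a 0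
  have h₄ := hy.weight_prefix a b
  simp only [mul_zero, zero_add, weight_zero] at h₁ h₂ h₃
  omega

theorem succ_eq_one_sub_of_weight_two {q : ℕ} (h : weight y q 2 = 1) : y (q + 1) = 1 - y q := by
  rw [weight_succ_left, weight_one] at h
  omega

theorem eq_tmInf_of_weight_even (h : ∀ a, weight y 0 (2 * a) = a) :
    y = tmInf fun i => y (2 * i) := by
  funext i
  obtain ⟨m, rfl | rfl⟩ := Nat.even_or_odd' i
  · rw [tmInf_even]
  · have hadd := weight_add y 0 (2 * m) 2
    rw [h, zero_add, ← Nat.mul_succ, h] at hadd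
    rw [tmInf_odd, succ_eq_one_sub_of_weight_two (y := y) (q := 2 * m) (by omega)]

theorem eq_tmInf_shift_of_weight_odd (h : ∀ b, weight y 0 (2 * b + 1) = weight y 0 1 + b) :
    y = fun i => tmInf (fun j => 1 - y (2 * j)) (1 + i) := by
  funext i
  obtain ⟨m, rfl | rfl⟩ := Nat.even_or_odd' i
  · rw [add_comm, tmInf_odd, sub_sub_cancel]
  · have hadd := weight_add y 0 (2 * m + 1) 2
    rw [h, zero_add, show 2 * m + 1 + 2 = 2 * (m + 1) + 1 by ring, h] at hadd
    have hpair := succ_eq_one_sub_of_weight_two (y := y) (q := 2 * m + 1) (by omega)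
    rw [show 1 + (2 * m + 1) = 2 * (m + 1) by ring, tmInf_even,
      show 2 * (m + 1) = 2 * m + 1 + 1 by ring, hpair, sub_sub_cancel]

theorem OddBalanced.exists_tmInf (hy : OddBalanced y) :
    ∃ (z : ℕ → Fin 2) (p : ℕ), p < 2 ∧ y = fun i => tmInf z (p + i) := by
  rcases hy.weight_prefix_even_or_odd with h | h
  · exact ⟨_, 0, two_pos, by simpa only [zero_add] using eq_tmInf_of_weight_even h⟩
  · exact ⟨_, 1, one_lt_two, eq_tmInf_shift_of_weight_odd h⟩

end Desubstitution

section PrefixRecurrent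

/-- Every prefix of `y` occurs in `y` arbitrarily far to the right. Unlike `Recurrent`, this is
visibly inherited by preimages under the Thue–Morse morphism. -/
def PrefixRecurrent {α : Type*} (y : ℕ → α) : Prop :=
  ∀ l q, ∃ g, q ≤ g ∧ block y g l = block y 0 l

theorem Recurrent.prefixRecurrent {α : Type*} {x : ℕ → α} (hx : Recurrent x) :
    PrefixRecurrent x := by
  intro l q
  obtain ⟨g, hg, hqg⟩ := (hx l (block x 0 l) ⟨0, rfl⟩).exists_gt q
  exact ⟨g, hqg.le, hg⟩

theorem PrefixRecurrent.factors_shift {α : Type*} {z : ℕ → α} (hz : PrefixRecurrent z)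
    (q n : ℕ) : factors (fun i => z (q + i)) n = factors z n := by
  refine Set.Subset.antisymm ?_ ?_
  · rintro _ ⟨i, rfl⟩
    exact ⟨q + i, (block_shift z i q n).symm⟩
  · rintro _ ⟨i, rfl⟩
    obtain ⟨g, hqg, hg⟩ := hz (i + n) q
    rw [block_eq_iff] at hg
    refine ⟨g + i - q, ?_⟩
    change block (fun i => z (q + i)) (g + i - q) n = block z i n
    rw [block_shift, Nat.add_sub_of_le (hqg.trans (Nat.le_add_right g i)), block_eq_iff]
    intro j hj
    rw [add_assoc, hg (i + j) (by omega), zero_add]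

theorem PrefixRecurrent.tmInf_iterate {y : ℕ → Fin 2} (hy : PrefixRecurrent y) (k : ℕ) :
    PrefixRecurrent (tmInf^[k] y) := by
  intro l q
  obtain ⟨g, hqg, hg⟩ := hy l q
  have hblock : block (tmInf^[k] y) (2 ^ k * g) (2 ^ k * l) =
      block (tmInf^[k] y) 0 (2 ^ k * l) := by
    rw [block_tmInf_iterate, hg, ← block_tmInf_iterate, mul_zero]
  rw [block_eq_iff] at hblock
  refine ⟨2 ^ k * g, hqg.trans (Nat.le_mul_of_pos_left g (Nat.two_pow_pos k)), ?_⟩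
  rw [block_eq_iff]
  exact fun i hi => hblock i (hi.trans_le (Nat.le_mul_of_pos_left l (Nat.two_pow_pos k)))

theorem mod_two_eq_one_of_tmInf_eq_succ {z : ℕ → Fin 2} {i : ℕ}
    (h : tmInf z i = tmInf z (i + 1)) : i % 2 = 1 := by
  obtain ⟨m, rfl | rfl⟩ := Nat.even_or_odd' i
  · have := val_one_sub (z m)
    rw [tmInf_even, tmInf_odd] at h
    omega
  · exact Nat.mul_add_mod 2 m 1

/-- A repeated letter straddles two images of letters, so it fixes the parity of its occurrences
and hence of the returns to any prefix that contains it. -/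
theorem PrefixRecurrent.of_tmInf {z : ℕ → Fin 2} {p : ℕ}
    (hz : PrefixRecurrent fun i => tmInf z (p + i)) (hp : p < 2)
    (hsquare : ∃ i, tmInf z (p + i) = tmInf z (p + (i + 1))) : PrefixRecurrent z := by
  obtain ⟨i, hi⟩ := hsquare
  intro l q
  obtain ⟨g, hqg, hg⟩ := hz (2 * l + i + 2) (2 * q)
  simp only [block_eq_iff, zero_add] at hg
  have hparity : (p + i) % 2 = 1 := mod_two_eq_one_of_tmInf_eq_succ hi
  have hparity' : (p + (g + i)) % 2 = 1 := by
    refine mod_two_eq_one_of_tmInf_eq_succ (z := z) ?_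
    rw [hg i (by omega), hi, ← hg (i + 1) (by omega), add_assoc p, add_assoc g]
  obtain ⟨d, rfl⟩ : ∃ d, g = 2 * d := ⟨g / 2, by omega⟩
  refine ⟨d, by omega, block_eq_iff.2 fun m hm => ?_⟩
  have hodd := hg (2 * m + 1 - p) (by omega)
  rw [show p + (2 * d + (2 * m + 1 - p)) = 2 * (d + m) + 1 by omega,
    show p + (2 * m + 1 - p) = 2 * m + 1 by omega, tmInf_odd, tmInf_odd, sub_right_inj] at hodd
  rw [hodd, zero_add]

theorem binomComplexity_congr {α : Type*} {x z : ℕ → α} (h : ∀ n, factors x n = factors z n)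
    (k : ℕ) : binomComplexity k x = binomComplexity k z := by
  funext n
  rw [binomComplexity, binomComplexity, h]

theorem exists_tmInf_iterate_of_tmProp (k : ℕ) {x : ℕ → Fin 2} (hrec : Recurrent x)
    (hx : TMProp k x) : ∃ (y : ℕ → Fin 2) (q : ℕ), PrefixRecurrent y ∧ q < 2 ^ k ∧
      x = fun i => tmInf^[k] y (q + i) := by
  induction k with
  | zero => exact ⟨x, 0, hrec.prefixRecurrent, one_pos, by simp only [zero_add]; rfl⟩
  | succ k ih =>
    obtain ⟨y, q, hy, hq, hxy⟩ := ih fun j hj hjk => hx j hj (by omega)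
    have hcomplexity :
        binomComplexity (k + 1) (tmInf^[k] y) = binomComplexity (k + 1) thueMorse := by
      rw [← hx (k + 1) k.succ_pos le_rfl, hxy]
      exact (binomComplexity_congr ((hy.tmInf_iterate k).factors_shift q) (k + 1)).symm
    obtain ⟨hbalanced, hsquare⟩ :=
      oddBalanced_and_exists_eq_succ_of_binomComplexity_eq k hcomplexity
    obtain ⟨z, p, hp, rfl⟩ := hbalanced.exists_tmInf
    refine ⟨z, 2 ^ k * p + q, hy.of_tmInf hp hsquare, ?_, ?_⟩
    · have := Nat.mul_le_mul_left (2 ^ k) (Nat.le_of_lt_succ hp)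
      rw [pow_succ]
      omega
    · rw [hxy]
      funext i
      rw [tmInf_iterate_shift, Function.iterate_succ_apply, add_assoc]

end PrefixRecurrent

section Concat

theorem concat_nil {α : Type*} (z : ℕ → α) : concat [] z = z := by
  funext i
  simp [concat]

theorem shift_eq_concat {α : Type*} (z : ℕ → α) (q n : ℕ) :
    (fun i => z (q + i)) = concat (block z q n) fun i => z (q + n + i) := by
  funext i
  simp only [concat, length_block]
  split_ifs with h
  · simp [block]
  · rw [add_assoc, Nat.add_sub_of_le (not_lt.1 h)]

theorem tmInf_iterate_shift_eq_concat {k q : ℕ} (y : ℕ → Fin 2) (hq : q < 2 ^ k) :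
    (fun i => tmInf^[k] y (q + i)) =
      concat (block (tmInf^[k] y) q (2 ^ k - q)) (tmInf^[k] fun i => y (1 + i)) := by
  rw [shift_eq_concat _ q (2 ^ k - q), Nat.add_sub_of_le hq.le]
  congr 1
  funext i
  rw [tmInf_iterate_shift, mul_one]

theorem block_tmInf_iterate_suffix {k q : ℕ} (y : ℕ → Fin 2) (hq : q < 2 ^ k) :
    block (tmInf^[k] y) q (2 ^ k - q) <:+ tm^[k] [y 0] := by
  have hprefix : block (tmInf^[k] y) 0 (q + (2 ^ k - q)) = tm^[k] [y 0] := by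
    have := block_tmInf_iterate y k 0 1
    rwa [mul_zero, mul_one, ← Nat.add_sub_of_le hq.le] at this
  rw [← hprefix, block_add, zero_add]
  exact List.suffix_append _ _

end Concat

end BinomialWords

theorem mainTheorem4 (k : ℕ) (hk : 1 ≤ k) (x : ℕ → Fin 2) (hrec : Recurrent x)
    (hx : TMProp k x) :
    ∃ (y : ℕ → Fin 2) (u : List (Fin 2)) (a : Fin 2),
      u <:+ tm^[k] [a] ∧ u ≠ tm^[k] [a] ∧ x = concat u (tmInf^[k] y) := by
  have hlength (a : Fin 2) : (tm^[k] [a]).length = 2 ^ k := by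
    rw [length_tm_iterate_eq, List.length_singleton, mul_one]
  obtain ⟨y, q, -, hq, rfl⟩ := exists_tmInf_iterate_of_tmProp k hrec hx
  rcases q.eq_zero_or_pos with rfl | hq_pos
  · refine ⟨y, [], 0, List.nil_suffix, fun h => ?_, ?_⟩
    · exact (Nat.two_pow_pos k).ne ((congrArg List.length h).trans (hlength 0))
    · simp only [zero_add, concat_nil]
  · refine ⟨_, _, y 0, block_tmInf_iterate_suffix y hq, fun h => ?_,
      tmInf_iterate_shift_eq_concat y hq⟩
    have := (congrArg List.length h).trans (hlength (y 0))
    rw [length_block] at this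
    omega
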